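/- Let $k>0$, $R>0$ and $B_R=\{x\in\mathbb R^2: |x|<R\}$. Let $D\subset\mathbb R^2$ be an open set with Lipschitz boundary (locally, $D$ lies on one side of the graph of a Lipschitz function) and $\overline D\subset B_R$. Identify $S^1\subset\mathbb R^2$ with the unit circle of $\mathbb C$. For $g\in L^2(S^1)$ let $$Hg(x)=\int_{S^1}e^{ikx\cdot\varphi}g(\varphi)\,d\sigma(\varphi),\qquad x\in\mathbb R^2,$$ where $\sigma$ is arc length. For integers $n,N\ge 1$, $s>0$, $y\in B_R$ and $\omega\in S^1$ put $$g^{1/n}_{(y,\omega)}(\varphi;s,k)_N=\frac{e^{-iky\cdot\varphi}}{2\pi}\sum_{m=0}^{nN}\frac{\Gamma(m+1)}{\Gamma(\frac mn+1)}\left(\frac{s\,\overline\omega\,\varphi}{ik}\right)^m,\qquad \varphi\in S^1,$$ $$C_y(\omega,\pi/2n)=\{x\in\mathbb R^2:(x-y)\cdot\omega>|x-y|\cos(\pi/2n)\}.$$ Let $\gamma_0$ be the unique positive solution of $\log t+t/e=0$, let $0<\gamma<\gamma_0$ and $n\ge1$, and let $\{s(N)\}_{N\ge1}$ be any sequence of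 positive numbers with $(Rs(N))^n=\frac{\gamma}{e}N+O(1)$ as $N\to\infty$. Then for every $(y,\omega)\in B_R\times S^1$: (i) if $\overline{C_y(\omega,\pi/2n)}\cap\overline D=\emptyset$, then $\displaystyle\lim_{N\to\infty}\big\Vert Hg^{1/n}_{(y,\omega)}(\,\cdot\,;s(N),k)_N\big\Vert_{H^1(D)}=0$; (ii) if $C_y(\omega,\pi/2n)\cap D\neq\emptyset$, then $\displaystyle\lim_{N\to\infty}\big\Vert Hg^{1/n}_{(y,\omega)}(\,\cdot\,;s(N),k)_N|_{\partial D}\big\Vert_{L^2(\partial D)}=\infty$. -/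

import Mathlib

open scoped Real ENNReal Topology ComplexConjugate

noncomputable section

namespace HerglotzCone

/-! The plane `ℝ²` is identified with `ℂ`: the Euclidean norm is `‖x‖`, the dot product `x · y` is
`inner ℝ x y = Re (conj x * y)`, Lebesgue measure is `volume`, and `S¹` is `Circle`. -/

/-- The density
`g(φ) = e^{-i k y·φ} / (2π) * ∑_{m=0}^{nN} Γ(m+1) / Γ(m/n+1) * (s ω̄ φ / (i k))^m`, `φ ∈ S¹`. -/
def density (n N : ℕ) (y : ℂ) (ω : Circle) (s k : ℝ) (φ : Circle) : ℂ :=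
  Complex.exp (-(Complex.I * k * (inner ℝ y (φ : ℂ) : ℝ))) / (2 * π) *
    ∑ m ∈ Finset.range (n * N + 1),
      ((Real.Gamma ((m : ℝ) + 1) / Real.Gamma ((m : ℝ) / n + 1) : ℝ) : ℂ) *
        ((s : ℂ) * conj (ω : ℂ) * (φ : ℂ) / (Complex.I * k)) ^ m

/-- The Herglotz wave function `Hg(x) = ∫_{S¹} e^{i k x·φ} g(φ) dσ(φ)`, where `σ` is arc length
on the unit circle, written through `φ = e^{iθ}`, `0 ≤ θ ≤ 2π`. -/
def herglotz (k : ℝ) (g : Circle → ℂ) (x : ℂ) : ℂ :=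
  ∫ θ in (0 : ℝ)..(2 * π),
    Complex.exp (Complex.I * k * (inner ℝ x (Circle.exp θ : ℂ) : ℝ)) * g (Circle.exp θ)

/-- The open cone with vertex `y`, axis `ω` and half-angle `a`. -/
def cone (y : ℂ) (ω : Circle) (a : ℝ) : Set ℂ :=
  {x | ‖x - y‖ * Real.cos a < inner ℝ (x - y) (ω : ℂ)}

/-- `D` has Lipschitz boundary: near each boundary point, in suitable orthonormal coordinates
(with axes `e` and `i e`), `D` is the part of the plane above the graph of a Lipschitz function. -/
def HasLipschitzBoundary (D : Set ℂ) : Prop :=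
  ∀ p ∈ frontier D, ∃ (r : ℝ) (e : Circle) (K : NNReal) (f : ℝ → ℝ),
    0 < r ∧ LipschitzWith K f ∧
    ∀ x ∈ Metric.ball p r,
      (x ∈ D ↔ f (inner ℝ x (e : ℂ)) < inner ℝ x (Complex.I * (e : ℂ)))

/-- `G = (G 0, G 1)` is a weak gradient of `v` on the open set `U`; the coordinate directions are
`1` and `i`. -/
def IsWeakGradient (U : Set ℂ) (v : ℂ → ℂ) (G : Fin 2 → ℂ → ℂ) : Prop :=
  MeasureTheory.LocallyIntegrableOn v U ∧
  ∀ j : Fin 2, MeasureTheory.LocallyIntegrableOn (G j) U ∧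
    ∀ φ : ℂ → ℝ, ContDiff ℝ (⊤ : ℕ∞) φ → HasCompactSupport φ → tsupport φ ⊆ U →
      ∫ x in U, (fderiv ℝ φ x (![1, Complex.I] j)) • v x = -∫ x in U, φ x • G j x

/-- The norm `(‖v‖²_{L²(U)} + ‖∇v‖²_{L²(U)})^{1/2}` of the Sobolev space `H¹(U)`, `U` open, with
values in `[0, ∞]`. The weak gradient is unique up to null sets, so the infimum is over one value;
it is `∞` if there is no weak gradient. -/
def h1Norm (U : Set ℂ) (v : ℂ → ℂ) : ℝ≥0∞ :=
  ⨅ (G : Fin 2 → ℂ → ℂ) (_ : IsWeakGradient U v G),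
    (MeasureTheory.eLpNorm v 2 (MeasureTheory.volume.restrict U) ^ 2 +
      ∑ j, MeasureTheory.eLpNorm (G j) 2 (MeasureTheory.volume.restrict U) ^ 2) ^ (1 / 2 : ℝ)

/-- The norm of `L²(∂D)` with respect to arc length, i.e. one-dimensional Hausdorff measure,
with values in `[0, ∞]`. -/
def l2BoundaryNorm (D : Set ℂ) (v : ℂ → ℂ) : ℝ≥0∞ :=
  MeasureTheory.eLpNorm v 2 ((MeasureTheory.Measure.hausdorffMeasure (1 : ℝ)).restrict (frontier D))

end HerglotzCone

end

open scoped Real ENNReal Topology ComplexConjugate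

noncomputable section

namespace HerglotzCone

open Filter Finset

/-! Put W = s ω̄ (x - y) / 2 and q = k²|x - y|² / 4. By a Jacobi–Anger computation
(`herglotz_density`) the Herglotz function equals ∑_{m ≤ nN} W^m h_m(q) / Γ(m/n + 1), where h_m is
the Bessel function J_m normalized by h_m(0) = 1. Without the factors h_m this is a truncation of
the Mittag-Leffler series E(W) = ∑ W^m / Γ(m/n + 1), which is of size e^{Re W^n} for |arg W| < π/2n
and O(1/|W|) strictly outside the closure of that sector. The sector in W is the cone in x, and s(N)
→ ∞; hence the dichotomy.

Behaviour of E. The function E solves a first-order linear equation, so e^{-w^n} E(w) is a primitive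
of e^{-w^n} times a polynomial (`hasDerivAt_modulated`). Comparison along rays (`ray_comparison`)
bounds E where Re w^n is negative and in the central sector. On a ray through an n-th root of unity
ζ the primitive tends to ∑_{j<n} ζ^j, which is n for ζ = 1 and 0 otherwise
(`tendsto_modulated_ray`): so E grows around the positive axis only. Phragmén–Lindelöf fills the
gaps between the other root rays and the decay wedges (`exists_bound_outside_sector`), and
`exists_lower_bound_sector` gives the lower bound.

Truncation. Since |x - y| < 2R, X = |W|^n is at most (Rs)^n, about γN/e. The tail is at most a
polynomial in N times X^N e^X / N!, hence of order (γ e^{γ/e})^N up to that polynomial and an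
arbitrarily small increase of γ. The base is below 1 exactly when γ < γ₀
(`exists_truncation_error`).

Bessel factors. The identity h_m(q) = 1 - q ∫₀¹ t^m h_1(q(1-t)) dt (`besselFactor_eq_integral`)
depends on m only through t^m, so the full sum is p(W) - q ∫₀¹ p(tW) h_1(q(1-t)) dt with p the
truncated series. Off the cone the integral is O(log|W| / |W|) plus the truncation error; inside it
is O(e^X / X) with X = Re W^n plus that error, of lower order than p(W). For the gradient, Cauchy's
estimate controls w p'(w), and h_m' has a similar integral formula with h_0.

For (ii), a bounded D meeting the cone has a boundary point in the open cone, and a Lipschitz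
boundary has positive length near each of its points. -/

/-! ### Power series with coefficients `O(1/m!)` -/

lemma summable_pow_mul_of_le_factorial {c : ℕ → ℂ} {C : ℝ} (hc : ∀ m, ‖c m‖ ≤ C / m.factorial)
    (x : ℂ) : Summable fun m => c m * x ^ m := by
  refine Summable.of_norm_bounded ((Real.summable_pow_div_factorial ‖x‖).mul_left C) fun m => ?_
  rw [norm_mul, norm_pow]
  calc _ ≤ C / m.factorial * ‖x‖ ^ m := by gcongr; exact hc m
    _ = _ := by ring

lemma le_factorial_shift {c : ℕ → ℂ} {C : ℝ} (hc : ∀ m, ‖c m‖ ≤ C / m.factorial) (m : ℕ) :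
    ‖((m : ℂ) + 1) * c (m + 1)‖ ≤ C / m.factorial := by
  rw [norm_mul]
  have h1 : ‖(m : ℂ) + 1‖ = m + 1 := by
    rw [← Nat.cast_succ, Complex.norm_natCast]; simp
  rw [h1]
  calc _ ≤ (m + 1 : ℝ) * (C / (m + 1).factorial) := by gcongr; exact hc _
    _ = _ := by
      rw [Nat.factorial_succ]; push_cast
      have := m.factorial_pos
      field_simp

/-- Termwise differentiation of a power series whose coefficients are `O(1 / m!)`. -/
lemma hasDerivAt_tsum_pow {c : ℕ → ℂ} {C : ℝ} (hc : ∀ m, ‖c m‖ ≤ C / m.factorial) (x : ℂ) :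
    HasDerivAt (fun x => ∑' m, c m * x ^ m) (∑' m : ℕ, ((m : ℂ) + 1) * c (m + 1) * x ^ m) x := by
  have hC : 0 ≤ C := by have := (norm_nonneg _).trans (hc 0); simpa using this
  set r := ‖x‖ + 1
  have hr : 0 ≤ r := by positivity
  have hder : ∀ m y, HasDerivAt (fun y => c m * y ^ m) (c m * (m * y ^ (m - 1))) y :=
    fun m y => (hasDerivAt_pow m y).const_mul (c m)
  have hu : Summable fun m : ℕ => C / m.factorial * (m * r ^ (m - 1)) := by
    rw [← summable_nat_add_iff 1]
    refine ((Real.summable_pow_div_factorial r).mul_left C).congr fun m => ?_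
    rw [Nat.factorial_succ, add_tsub_cancel_right]; push_cast
    have := m.factorial_pos
    field_simp
  have key := hasDerivAt_tsum_of_isPreconnected (t := Metric.ball (0 : ℂ) r) (y₀ := 0) (y := x) hu
    Metric.isOpen_ball (convex_ball _ _).isPreconnected (fun m y _ => hder m y) ?_
    (by simp [r]; positivity) (summable_pow_mul_of_le_factorial hc 0) (by simp [r])
  · have e : ∑' m, c m * (m * x ^ (m - 1)) = ∑' m : ℕ, ((m : ℂ) + 1) * c (m + 1) * x ^ m := by
      have hs : Summable fun m : ℕ => c (m + 1) * ((m + 1 : ℕ) * x ^ (m + 1 - 1)) := by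
        refine (summable_pow_mul_of_le_factorial (le_factorial_shift hc) x).congr fun m => ?_
        rw [add_tsub_cancel_right]; push_cast; ring
      rw [((summable_nat_add_iff (f := fun m : ℕ => c m * (m * x ^ (m - 1))) 1).mp
        hs).tsum_eq_zero_add]
      simp only [Nat.cast_zero, zero_mul, mul_zero, zero_add]
      refine tsum_congr fun m => ?_
      rw [add_tsub_cancel_right]; push_cast; ring
    rw [← e]; exact key
  · intro m y hy
    rw [norm_mul, norm_mul, norm_pow, Complex.norm_natCast]
    have : ‖y‖ ≤ r := by simpa using (mem_ball_zero_iff.mp hy).le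
    gcongr
    exact hc m

/-! ### The series `∑ x^m / Γ(m + a + 1)` -/

/-- The coefficients `1 / Γ(m + a + 1)`. -/
def gammaCoeff (a : ℝ) (m : ℕ) : ℝ := (Real.Gamma (m + a + 1))⁻¹

lemma gammaCoeff_nonneg {a : ℝ} (ha : 0 ≤ a) (m : ℕ) : 0 ≤ gammaCoeff a m :=
  inv_nonneg.mpr (Real.Gamma_pos_of_pos (by positivity)).le

lemma add_mul_gammaCoeff {a : ℝ} (ha : 0 ≤ a) (m : ℕ) :
    (m + a) * gammaCoeff a m = (Real.Gamma (m + a))⁻¹ := by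
  unfold gammaCoeff
  rcases eq_or_ne ((m : ℝ) + a) 0 with h | h
  -- At the pole both sides vanish: `Real.Gamma 0 = 0` and `0⁻¹ = 0`, which agrees with the zero of
  -- 1/Γ there.
  · simp [h]
  · rw [Real.Gamma_add_one h]
    have : Real.Gamma (m + a) ≠ 0 :=
      (Real.Gamma_pos_of_pos (lt_of_le_of_ne (by positivity) h.symm)).ne'
    field_simp

/-- Each factor in Γ(m+a+1) = (m+a)⋯(1+a) Γ(a+1) is at least the corresponding factor of m!. -/
lemma gammaCoeff_le {a : ℝ} (ha : 0 ≤ a) (m : ℕ) :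
    gammaCoeff a m ≤ (Real.Gamma (a + 1))⁻¹ / m.factorial := by
  have h1 : 0 < Real.Gamma (a + 1) := Real.Gamma_pos_of_pos (by positivity)
  have key : Real.Gamma (a + 1) * m.factorial ≤ Real.Gamma (m + a + 1) := by
    induction m with
    | zero => simp
    | succ m ih =>
      have : ((m + 1 : ℕ) : ℝ) + a + 1 = (m + a + 1) + 1 := by push_cast; ring
      rw [this, Real.Gamma_add_one (s := m + a + 1) (by positivity), Nat.factorial_succ]
      push_cast
      have h2 : (m : ℝ) + 1 ≤ m + a + 1 := by linarith
      calc _ = ((m : ℝ) + 1) * (Real.Gamma (a + 1) * m.factorial) := by ring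
        _ ≤ _ := by gcongr
  unfold gammaCoeff
  rw [div_eq_mul_inv, ← mul_inv]
  gcongr

lemma norm_gammaCoeff_le {a : ℝ} (ha : 0 ≤ a) (m : ℕ) :
    ‖(gammaCoeff a m : ℂ)‖ ≤ (Real.Gamma (a + 1))⁻¹ / m.factorial := by
  rw [Complex.norm_real, Real.norm_of_nonneg (gammaCoeff_nonneg ha m)]
  exact gammaCoeff_le ha m

/-- The entire function `∑ x^m / Γ(m + a + 1)`, i.e. `E_{1,a+1}`. -/
def gammaSeries (a : ℝ) (x : ℂ) : ℂ := ∑' m, (gammaCoeff a m : ℂ) * x ^ m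

lemma summable_gammaSeries {a : ℝ} (ha : 0 ≤ a) (x : ℂ) :
    Summable fun m => (gammaCoeff a m : ℂ) * x ^ m :=
  summable_pow_mul_of_le_factorial (norm_gammaCoeff_le ha) x

/-- Comparison of coefficients: (m+a) c_m = c_{m-1} for m ≥ 1, while the constant term contributes a
c_0 = 1/Γ(a). -/
lemma hasDerivAt_gammaSeries {a : ℝ} (ha : 0 ≤ a) (x : ℂ) :
    ∃ g', HasDerivAt (gammaSeries a) g' x ∧
      x * g' + a * gammaSeries a x = ((Real.Gamma a)⁻¹ : ℝ) + x * gammaSeries a x := by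
  refine ⟨_, hasDerivAt_tsum_pow (norm_gammaCoeff_le ha) x, ?_⟩
  have hs := summable_gammaSeries ha x
  have hs' := summable_pow_mul_of_le_factorial (le_factorial_shift (norm_gammaCoeff_le ha)) x
  have h1 : a * gammaSeries a x = (a * gammaCoeff a 0 : ℝ)
      + ∑' m : ℕ, (a : ℂ) * (gammaCoeff a (m + 1) : ℂ) * x ^ (m + 1) := by
    unfold gammaSeries
    rw [hs.tsum_eq_zero_add, mul_add, ← tsum_mul_left]
    simp [mul_assoc]
  rw [h1, ← tsum_mul_left, add_left_comm, ← Summable.tsum_add]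
  · have h0 := add_mul_gammaCoeff ha 0
    simp only [Nat.cast_zero, zero_add] at h0
    rw [h0, gammaSeries, ← tsum_mul_left]
    congr 1
    refine tsum_congr fun m => ?_
    have := add_mul_gammaCoeff ha (m + 1)
    have h3 : gammaCoeff a m = (Real.Gamma ((m + 1 : ℕ) + a))⁻¹ := by
      unfold gammaCoeff; congr 2; push_cast; ring
    rw [← h3] at this
    rw [← this]; push_cast; ring
  · exact hs'.mul_left x
  · refine (((summable_nat_add_iff 1).mpr hs).mul_left (a : ℂ)).congr fun m => ?_
    ring

/-! ### The Mittag-Leffler function and its differential equation -/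

/-- The Mittag-Leffler function `E_{1/n}(w) = ∑ w^m / Γ(m/n + 1)`, grouped by residues mod `n`. -/
def mittagLeffler (n : ℕ) (w : ℂ) : ℂ :=
  ∑ j ∈ range n, w ^ j * gammaSeries ((j : ℝ) / n) (w ^ n)

/-- The inhomogeneity `∑_{0<j<n} w^{j-1} / Γ(j/n)`. -/
def forcing (n : ℕ) (w : ℂ) : ℂ :=
  ∑ j ∈ range n, w ^ (j - 1) * ((Real.Gamma ((j : ℝ) / n))⁻¹ : ℝ)

lemma gammaSeries_zero (x : ℂ) : gammaSeries 0 x = Complex.exp x := by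
  rw [Complex.exp_eq_exp_ℂ, NormedSpace.exp_eq_tsum_div, gammaSeries]
  refine tsum_congr fun m => ?_
  rw [gammaCoeff, add_zero, Real.Gamma_nat_eq_factorial]
  push_cast
  ring

/-- Each residue class obeys the equation of `gammaSeries` with a = j/n, and the factor w^j absorbs
the term a g. The class j = 0 is e^{w^n} and is unforced, in accordance with 1/Γ(0) = 0. -/
lemma hasDerivAt_mittagLeffler {n : ℕ} (hn : 1 ≤ n) (w : ℂ) :
    HasDerivAt (mittagLeffler n)
      (n * w ^ (n - 1) * mittagLeffler n w + n * forcing n w) w := by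
  have key : ∀ j ∈ range n, HasDerivAt (fun w : ℂ => w ^ j * gammaSeries ((j : ℝ) / n) (w ^ n))
      (n * w ^ (n - 1) * (w ^ j * gammaSeries ((j : ℝ) / n) (w ^ n)) +
        n * (w ^ (j - 1) * ((Real.Gamma ((j : ℝ) / n))⁻¹ : ℝ))) w := by
    intro j _
    have hn0 : (n : ℂ) ≠ 0 := by exact_mod_cast (by omega : n ≠ 0)
    have hw : w ^ n = w * w ^ (n - 1) := by rw [← pow_succ']; congr 1; omega
    rcases j with _ | j
    · have h := (hasDerivAt_pow n w).cexp
      simp only [CharP.cast_eq_zero, zero_div, pow_zero, one_mul, gammaSeries_zero,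
        Real.Gamma_zero, inv_zero, Complex.ofReal_zero, mul_zero, add_zero]
      exact h.congr_deriv (by ring)
    · obtain ⟨g', hg, hode⟩ :=
        hasDerivAt_gammaSeries (a := ((j + 1 : ℕ) : ℝ) / n) (by positivity) (w ^ n)
      have hc : HasDerivAt (fun w : ℂ => gammaSeries (((j + 1 : ℕ) : ℝ) / n) (w ^ n))
          (g' * (n * w ^ (n - 1))) w := hg.comp w (hasDerivAt_pow n w)
      have h := (hasDerivAt_pow (j + 1) w).fun_mul hc
      refine h.congr_deriv ?_
      have e1 : (((j + 1 : ℕ) : ℂ)) = n * (((j + 1 : ℕ) : ℝ) / n : ℝ) := by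
        push_cast; field_simp
      simp only [add_tsub_cancel_right]
      rw [e1]
      have e2 : w ^ (j + 1) * (g' * (n * w ^ (n - 1))) = n * w ^ j * (w ^ n * g') := by
        rw [hw]; ring
      rw [e2, eq_sub_of_add_eq hode, hw]
      ring
  have h := HasDerivAt.fun_sum key
  rw [sum_add_distrib, ← mul_sum, ← mul_sum] at h
  exact h

lemma differentiable_mittagLeffler {n : ℕ} (hn : 1 ≤ n) : Differentiable ℂ (mittagLeffler n) :=
  fun w => (hasDerivAt_mittagLeffler hn w).differentiableAt

/-- A crude bound on the order of growth. -/
lemma norm_gammaSeries_le {a : ℝ} (ha : 0 ≤ a) (x : ℂ) :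
    ‖gammaSeries a x‖ ≤ (Real.Gamma (a + 1))⁻¹ * Real.exp ‖x‖ := by
  have h : HasSum (fun m : ℕ => (Real.Gamma (a + 1))⁻¹ * (‖x‖ ^ m / m.factorial))
      ((Real.Gamma (a + 1))⁻¹ * Real.exp ‖x‖) := by
    have := NormedSpace.expSeries_div_hasSum_exp (𝔸 := ℝ) ‖x‖
    rw [← Real.exp_eq_exp_ℝ] at this
    exact this.mul_left _
  refine tsum_of_norm_bounded h fun m => ?_
  rw [norm_mul, norm_pow]
  calc _ ≤ (Real.Gamma (a + 1))⁻¹ / m.factorial * ‖x‖ ^ m := by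
        gcongr; exact norm_gammaCoeff_le ha m
    _ = _ := by ring

/-- Supplies the constants on small discs and the growth order required by Phragmén–Lindelöf. -/
lemma exists_norm_mittagLeffler_le (n : ℕ) :
    ∃ A, 0 ≤ A ∧ ∀ w, ‖mittagLeffler n w‖ ≤ A * (1 + ‖w‖) ^ n * Real.exp (‖w‖ ^ n) := by
  refine ⟨∑ j ∈ range n, (Real.Gamma ((j : ℝ) / n + 1))⁻¹, ?_, fun w => ?_⟩
  · exact sum_nonneg fun j _ => inv_nonneg.mpr (Real.Gamma_pos_of_pos (by positivity)).le
  · rw [mittagLeffler, sum_mul, sum_mul]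
    refine (norm_sum_le _ _).trans (sum_le_sum fun j hj => ?_)
    rw [norm_mul, norm_pow]
    have hG : 0 ≤ (Real.Gamma ((j : ℝ) / n + 1))⁻¹ :=
      inv_nonneg.mpr (Real.Gamma_pos_of_pos (by positivity)).le
    have h1 : ‖w‖ ^ j ≤ (1 + ‖w‖) ^ n :=
      (pow_le_pow_left₀ (norm_nonneg w) (by linarith) j).trans
        (pow_le_pow_right₀ (by linarith [norm_nonneg w]) (mem_range.mp hj).le)
    calc _ ≤ (1 + ‖w‖) ^ n * ((Real.Gamma ((j : ℝ) / n + 1))⁻¹ * Real.exp ‖w ^ n‖) := by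
          gcongr; exact norm_gammaSeries_le (by positivity) _
      _ = _ := by rw [norm_pow]; ring

/-! ### Removing the exponential; comparison along rays -/

/-- The Mittag-Leffler function with the exponential `e^{w^n}` factored out. -/
def modulated (n : ℕ) (w : ℂ) : ℂ := Complex.exp (-w ^ n) * mittagLeffler n w

lemma norm_modulated (n : ℕ) (w : ℂ) :
    ‖modulated n w‖ = Real.exp (-(w ^ n).re) * ‖mittagLeffler n w‖ := by
  rw [modulated, norm_mul, Complex.norm_exp, Complex.neg_re]

lemma norm_mittagLeffler_eq (n : ℕ) (w : ℂ) :
    ‖mittagLeffler n w‖ = Real.exp ((w ^ n).re) * ‖modulated n w‖ := by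
  rw [norm_modulated, ← mul_assoc, ← Real.exp_add]; simp

/-- e^{-w^n} is the integrating factor of the equation for E, so only the forcing survives. -/
lemma hasDerivAt_modulated {n : ℕ} (hn : 1 ≤ n) (w : ℂ) :
    HasDerivAt (modulated n) (n * Complex.exp (-w ^ n) * forcing n w) w := by
  have h := ((hasDerivAt_pow n w).fun_neg.cexp).fun_mul (hasDerivAt_mittagLeffler hn w)
  exact h.congr_deriv (by ring)

/-- The term j = 0 vanishes, so the forcing has degree at most n - 2. The two spare powers of |w|
become the decay 1/|w| of E. -/
lemma exists_forcing_bound (n : ℕ) :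
    ∃ C, 0 ≤ C ∧ ∀ w : ℂ, 1 ≤ ‖w‖ → ‖forcing n w‖ * ‖w‖ ^ 2 ≤ C * ‖w‖ ^ n := by
  refine ⟨∑ j ∈ range n, |(Real.Gamma ((j : ℝ) / n))⁻¹|, sum_nonneg fun _ _ => abs_nonneg _,
    fun w hw => ?_⟩
  have : ‖forcing n w‖ ≤ ∑ j ∈ range n, ‖w‖ ^ (j - 1) * |(Real.Gamma ((j : ℝ) / n))⁻¹| := by
    refine (norm_sum_le _ _).trans (sum_le_sum fun j _ => ?_)
    rw [norm_mul, norm_pow, Complex.norm_real, Real.norm_eq_abs]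
  refine (mul_le_mul_of_nonneg_right this (by positivity)).trans ?_
  rw [sum_mul, sum_mul]
  refine sum_le_sum fun j hj => ?_
  rcases Nat.eq_zero_or_pos j with rfl | hj0
  · simp
  · calc _ = |(Real.Gamma ((j : ℝ) / n))⁻¹| * ‖w‖ ^ (j - 1 + 2) := by ring
      _ ≤ _ := by
        have := mem_range.mp hj
        gcongr
        omega

lemma norm_modulated_deriv_le {n : ℕ} {C : ℝ}
    (hC : ∀ w : ℂ, 1 ≤ ‖w‖ → ‖forcing n w‖ * ‖w‖ ^ 2 ≤ C * ‖w‖ ^ n) {w : ℂ} (hw : 1 ≤ ‖w‖) :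
    ‖n * Complex.exp (-w ^ n) * forcing n w‖ ≤
      n * C * ‖w‖ ^ n / ‖w‖ ^ 2 * Real.exp (-(w ^ n).re) := by
  have h2 : 0 < ‖w‖ ^ 2 := by positivity
  rw [norm_mul, norm_mul, Complex.norm_exp, Complex.norm_natCast, Complex.neg_re]
  have : ‖forcing n w‖ ≤ C * ‖w‖ ^ n / ‖w‖ ^ 2 := (le_div_iff₀ h2).mpr (hC w hw)
  calc _ ≤ n * Real.exp (-(w ^ n).re) * (C * ‖w‖ ^ n / ‖w‖ ^ 2) := by gcongr
    _ = _ := by ring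

lemma hasDerivAt_modulated_ray {n : ℕ} (hn : 1 ≤ n) (l : ℂ) (r : ℝ) :
    HasDerivAt (fun r : ℝ => modulated n (r * l))
      (n * Complex.exp (-(r * l) ^ n) * forcing n (r * l) * l) r := by
  have h1 : HasDerivAt (fun r : ℝ => (r : ℂ) * l) l r := by
    simpa using (Complex.ofRealCLM.hasDerivAt (x := r)).mul_const l
  exact (hasDerivAt_modulated hn _).comp r h1

/-- This derivative has the shape t^{n-2} e^{-ρ t^n} of the bound on the derivative of `modulated`,
so multiples of e^{-ρ t^n}/t serve as majorants. -/
lemma hasDerivAt_exp_pow_div (n : ℕ) (hn : 1 ≤ n) (ρ : ℝ) {t : ℝ} (ht : 0 < t) :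
    HasDerivAt (fun t : ℝ => Real.exp (-(ρ * t ^ n)) / t)
      (-(Real.exp (-(ρ * t ^ n)) / t ^ 2 * (ρ * n * t ^ n + 1))) t := by
  have h := (((hasDerivAt_pow n t).const_mul ρ).fun_neg.exp).fun_div (hasDerivAt_id t) ht.ne'
  refine h.congr_deriv ?_
  have : t ^ n = t ^ (n - 1) * t := by rw [← pow_succ]; congr 1; omega
  simp only [id]
  rw [this]
  field_simp
  ring

lemma re_ray_pow (n : ℕ) (l : ℂ) (r : ℝ) : (((r : ℂ) * l) ^ n).re = (l ^ n).re * r ^ n := by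
  rw [mul_pow, ← Complex.ofReal_pow, Complex.re_ofReal_mul, mul_comm]

lemma norm_ray {l : ℂ} (hl : ‖l‖ = 1) {r : ℝ} (hr : 0 ≤ r) : ‖(r : ℂ) * l‖ = r := by
  rw [norm_mul, hl, Complex.norm_real, Real.norm_of_nonneg hr, mul_one]

/-- Comparison along a ray, with the derivative of `M₀ ∓ M e^{-ρ t^n} / t` as majorant. -/
lemma ray_comparison {n : ℕ} (hn : 1 ≤ n) {C : ℝ}
    (hC : ∀ w : ℂ, 1 ≤ ‖w‖ → ‖forcing n w‖ * ‖w‖ ^ 2 ≤ C * ‖w‖ ^ n) {l : ℂ} (hl : ‖l‖ = 1)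
    {a b M M₀ : ℝ} {z : ℂ} (ha : 1 ≤ a) (hab : a ≤ b)
    (hM : ∀ t, a ≤ t → n * C * t ^ n ≤ -M * ((l ^ n).re * n * t ^ n + 1))
    (hini : ‖modulated n (a * l) - z‖ ≤ M₀ + M * (Real.exp (-((l ^ n).re * a ^ n)) / a)) :
    ‖modulated n (b * l) - z‖ ≤ M₀ + M * (Real.exp (-((l ^ n).re * b ^ n)) / b) := by
  have hf : ∀ t : ℝ, HasDerivAt (fun r : ℝ => modulated n (r * l) - z)
      (n * Complex.exp (-(t * l) ^ n) * forcing n (t * l) * l) t :=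
    fun t => (hasDerivAt_modulated_ray hn l t).sub_const z
  have hB : ∀ t : ℝ, a ≤ t → HasDerivAt
      (fun t => M₀ + M * (Real.exp (-((l ^ n).re * t ^ n)) / t)) _ t :=
    fun t ht => ((hasDerivAt_exp_pow_div n hn (l ^ n).re (by linarith)).const_mul M).const_add M₀
  refine image_norm_le_of_norm_deriv_right_le_deriv_boundary'
    (fun t _ => (hf t).continuousAt.continuousWithinAt) (fun t _ => (hf t).hasDerivWithinAt)
    hini (fun t ht => (hB t ht.1).continuousAt.continuousWithinAt)
    (fun t ht => (hB t ht.1).hasDerivWithinAt) (fun t ht => ?_) ⟨hab, le_rfl⟩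
  have ht1 : 1 ≤ t := ha.trans ht.1
  have hn1 := norm_ray hl (r := t) (by linarith)
  rw [norm_mul, hl, mul_one]
  refine (norm_modulated_deriv_le hC (by rwa [hn1])).trans ?_
  rw [hn1, re_ray_pow]
  have := hM t ht.1
  calc _ = n * C * t ^ n * (Real.exp (-((l ^ n).re * t ^ n)) / t ^ 2) := by ring
    _ ≤ -M * ((l ^ n).re * n * t ^ n + 1) * (Real.exp (-((l ^ n).re * t ^ n)) / t ^ 2) := by
      gcongr
    _ = _ := by ring

/-- In the wedges where `Re w^n ≤ -c |w|^n`, the Mittag-Leffler function is `O(1 / |w|)`. -/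
lemma exists_bound_decay_wedge {n : ℕ} (hn : 1 ≤ n) {c : ℝ} (hc : 0 < c) :
    ∃ K, ∀ (l : ℂ) (r : ℝ), ‖l‖ = 1 → 0 ≤ r → (l ^ n).re ≤ -c →
      r * ‖mittagLeffler n (r * l)‖ ≤ K := by
  obtain ⟨C, hC0, hC⟩ := exists_forcing_bound n
  obtain ⟨A, hA0, hA⟩ := exists_norm_mittagLeffler_le n
  -- For t ≥ 2/c the correction 1 in -ρ n t^n - 1 costs at most half of c n t^n, so e^{-ρ t^n}/t
  -- increases fast enough to be a majorant.
  set a := max 1 (2 / c)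
  have ha1 : 1 ≤ a := le_max_left _ _
  have ha2 : 2 / c ≤ a := le_max_right _ _
  set A' := A * (1 + a) ^ n * Real.exp (a ^ n)
  have hA' : 0 ≤ A' := by positivity
  -- The first summand dominates the derivative beyond a, the second the initial value at a.
  set M := 2 * C / c + A' * a
  have hM0 : 0 ≤ M := by positivity
  refine ⟨M, fun l r hl hr hρ => ?_⟩
  have small : ∀ r : ℝ, 0 ≤ r → r ≤ a → ‖mittagLeffler n (r * l)‖ ≤ A' := fun r hr hra => by
    refine (hA _).trans ?_
    rw [norm_ray hl hr]
    show _ ≤ A * (1 + a) ^ n * Real.exp (a ^ n)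
    gcongr
  rcases le_total r a with hra | hra
  · calc _ ≤ a * A' := by gcongr; exact small r hr hra
      _ ≤ M := by have : 0 ≤ 2 * C / c := by positivity
                  simp only [M]; linarith
  · have := ray_comparison hn hC hl (z := 0) (M := M) (M₀ := 0) ha1 hra ?_ ?_
    · rw [sub_zero, zero_add, norm_modulated, re_ray_pow] at this
      have hr0 : 0 < r := by linarith
      set e := Real.exp (-((l ^ n).re * r ^ n))
      have he : 0 < e := Real.exp_pos _
      have h3 : e * ‖mittagLeffler n (r * l)‖ * r ≤ M * e := by
        calc _ ≤ M * (e / r) * r := by gcongr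
          _ = _ := by field_simp
      nlinarith
    · intro t ht
      have ht1 : 1 ≤ t := ha1.trans ht
      have h1 : t ≤ t ^ n := le_self_pow₀ ht1 (by omega)
      have h2 : 2 ≤ c * t ^ n := by
        have := ha2.trans (ht.trans h1)
        rwa [div_le_iff₀' hc] at this
      have hn' : (1 : ℝ) ≤ n := by exact_mod_cast hn
      have htn : 0 < t ^ n := by positivity
      have h4 : 2 * C / c * c = 2 * C := by field_simp
      have h5 : C * (n * t ^ n) ≤ M * (c * (n * t ^ n) - 1) := by
        have h6 : 2 ≤ c * (n * t ^ n) := by nlinarith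
        have h7 : 2 * C / c ≤ M := by simp only [M]; have : 0 ≤ A' * a := by positivity
                                      linarith
        calc C * (n * t ^ n) = 2 * C / c * (c * (n * t ^ n) / 2) := by field_simp
          _ ≤ M * (c * (n * t ^ n) - 1) := by gcongr; linarith
      have h8 : M * (c * (n * t ^ n)) ≤ M * (-(l ^ n).re * (n * t ^ n)) := by
        gcongr; linarith
      nlinarith
    · rw [sub_zero, zero_add, norm_modulated, re_ray_pow]
      have ha0 : 0 < a := by linarith
      rw [← mul_div_assoc, le_div_iff₀ ha0]
      have h1 : ‖mittagLeffler n (a * l)‖ * a ≤ M := by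
        have := small a ha0.le le_rfl
        have h9 : 0 ≤ 2 * C / c := by positivity
        simp only [M]; nlinarith
      calc _ = Real.exp (-((l ^ n).re * a ^ n)) * (‖mittagLeffler n (a * l)‖ * a) := by ring
        _ ≤ Real.exp (-((l ^ n).re * a ^ n)) * M := by gcongr
        _ = _ := by ring

/-! ### Limits and bounds on the rays `w^n > 0` -/

/-- u^a e^{-u} is the integrating factor of u g' + a g = 1/Γ(a) + u g; the result is the density of
the Gamma distribution. -/
lemma hasDerivAt_rpow_mul_gammaSeries {a : ℝ} (ha : 0 < a) {u : ℝ} (hu : 0 < u) :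
    HasDerivAt (fun u : ℝ => ((u ^ a : ℝ) : ℂ) * Complex.exp (-u) * gammaSeries a u)
      (((Real.exp (-u) * u ^ (a - 1) * (Real.Gamma a)⁻¹ : ℝ) : ℂ)) u := by
  obtain ⟨g', hg, hode⟩ := hasDerivAt_gammaSeries ha.le (u : ℂ)
  have h1 : HasDerivAt (fun u : ℝ => ((u ^ a : ℝ) : ℂ)) ((a * u ^ (a - 1) : ℝ) : ℂ) u :=
    (Real.hasDerivAt_rpow_const (Or.inl hu.ne')).ofReal_comp
  have h2 : HasDerivAt (fun u : ℝ => Complex.exp (-(u : ℂ))) (-Complex.exp (-u)) u := by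
    have := (Complex.ofRealCLM.hasDerivAt (x := u)).fun_neg.cexp
    simpa using this
  have h3 : HasDerivAt (fun u : ℝ => gammaSeries a u) g' u := hg.comp_ofReal
  refine ((h1.fun_mul h2).fun_mul h3).congr_deriv ?_
  have e : ((u ^ a : ℝ) : ℂ) = u * (u ^ (a - 1) : ℝ) := by
    rw [← Complex.ofReal_mul, Real.rpow_sub_one hu.ne']; congr 1; field_simp
  rw [e]
  push_cast
  rw [Complex.ofReal_inv] at hode
  linear_combination (((u ^ (a - 1) : ℝ) : ℂ) * Complex.exp (-u)) * hode

/-- The function is the integral of its derivative from 0, and the Gamma density has total mass 1.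
-/
lemma tendsto_rpow_mul_gammaSeries {a : ℝ} (ha : 0 < a) :
    Tendsto (fun u : ℝ => ((u ^ a : ℝ) : ℂ) * Complex.exp (-u) * gammaSeries a u) atTop (𝓝 1) := by
  have hi : MeasureTheory.IntegrableOn
      (fun u : ℝ => ((Real.exp (-u) * u ^ (a - 1) * (Real.Gamma a)⁻¹ : ℝ) : ℂ)) (Set.Ioi 0) :=
    ((Real.GammaIntegral_convergent ha).mul_const _).ofReal
  have h := MeasureTheory.intervalIntegral_tendsto_integral_Ioi 0 hi tendsto_id
  have e : ∫ u in Set.Ioi (0 : ℝ), ((Real.exp (-u) * u ^ (a - 1) * (Real.Gamma a)⁻¹ : ℝ) : ℂ)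
      = 1 := by
    rw [integral_complex_ofReal, MeasureTheory.integral_mul_const, ← Real.Gamma_eq_integral ha,
      mul_inv_cancel₀ (Real.Gamma_pos_of_pos ha).ne']
    simp
  rw [e] at h
  refine h.congr' ?_
  filter_upwards [eventually_ge_atTop 0] with x hx
  have hc : Continuous (gammaSeries a) := continuous_iff_continuousAt.mpr fun z => by
    obtain ⟨g', hg, -⟩ := hasDerivAt_gammaSeries ha.le z
    exact hg.continuousAt
  have hc1 : Continuous (fun u : ℝ => u ^ a) := Real.continuous_rpow_const ha.le
  rw [id, intervalIntegral.integral_eq_sub_of_hasDerivAt_of_le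
    (f := fun u : ℝ => ((u ^ a : ℝ) : ℂ) * Complex.exp (-u) * gammaSeries a u) hx
    (by fun_prop) (fun u hu => hasDerivAt_rpow_mul_gammaSeries ha hu.1)
    ((intervalIntegrable_iff_integrableOn_Ioc_of_le hx).mpr
      (hi.mono_set Set.Ioc_subset_Ioi_self))]
  simp [Real.zero_rpow ha.ne']

/-- With u = r^n and a = j/n, the weight u^a is r^j, so the residue class j contributes ζ^j in the
limit. The geometric sum then separates ζ = 1 from the other roots of unity. -/
lemma tendsto_modulated_ray {n : ℕ} (hn : 1 ≤ n) {ζ : ℂ} (hζ : ζ ^ n = 1) :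
    Tendsto (fun r : ℝ => modulated n (r * ζ)) atTop (𝓝 (∑ j ∈ range n, ζ ^ j)) := by
  have hn0 : (n : ℝ) ≠ 0 := by exact_mod_cast (by omega : n ≠ 0)
  have key : ∀ j ∈ range n, Tendsto (fun r : ℝ => Complex.exp (-(r * ζ) ^ n) *
      ((r * ζ) ^ j * gammaSeries ((j : ℝ) / n) ((r * ζ) ^ n))) atTop (𝓝 (ζ ^ j)) := by
    intro j _
    rcases Nat.eq_zero_or_pos j with rfl | hj
    · refine tendsto_const_nhds.congr fun r => ?_
      simp [gammaSeries_zero, ← Complex.exp_add]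
    · have ha : (0 : ℝ) < j / n := by positivity
      have h := ((tendsto_rpow_mul_gammaSeries ha).comp
        (tendsto_pow_atTop (α := ℝ) (by omega : n ≠ 0))).mul_const (ζ ^ j)
      rw [one_mul] at h
      refine h.congr' ?_
      filter_upwards [eventually_ge_atTop 0] with r hr
      have : (r ^ n) ^ ((j : ℝ) / n) = r ^ j := by
        rw [← Real.rpow_natCast r n, ← Real.rpow_mul hr, mul_div_cancel₀ _ hn0,
          Real.rpow_natCast]
      simp only [Function.comp, this]
      rw [mul_pow (r : ℂ) ζ n, hζ, mul_one]
      push_cast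
      ring
  refine (tendsto_finsetSum _ key).congr fun r => ?_
  rw [modulated, mittagLeffler, mul_sum]

/-- On rays where `w^n > 0`, other than the positive half-line, the Mittag-Leffler function is
`O(1 / |w|)`. -/
lemma exists_bound_root_ray {n : ℕ} (hn : 1 ≤ n) :
    ∃ K, ∀ (ζ : ℂ) (r : ℝ), ζ ^ n = 1 → ζ ≠ 1 → 0 ≤ r → r * ‖mittagLeffler n (r * ζ)‖ ≤ K := by
  obtain ⟨C, hC0, hC⟩ := exists_forcing_bound n
  obtain ⟨A, hA0, hA⟩ := exists_norm_mittagLeffler_le n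
  set A' := A * (1 + 1) ^ n * Real.exp (1 ^ n)
  have hA' : 0 ≤ A' := by positivity
  refine ⟨C + A', fun ζ r hζ hζ1 hr => ?_⟩
  have hl : ‖ζ‖ = 1 := Complex.norm_eq_one_of_pow_eq_one hζ (by omega)
  rcases le_total r 1 with hr1 | hr1
  · have : ‖mittagLeffler n (r * ζ)‖ ≤ A' := by
      refine (hA _).trans ?_
      rw [norm_ray hl hr]
      show _ ≤ A * (1 + 1) ^ n * Real.exp (1 ^ n)
      gcongr
    nlinarith [norm_nonneg (mittagLeffler n (r * ζ))]
  · have hlim := tendsto_modulated_ray hn hζ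
    have hs : ∑ j ∈ range n, ζ ^ j = 0 := by
      have := geom_sum_mul ζ n
      rw [hζ, sub_self] at this
      exact (mul_eq_zero.mp this).resolve_right (sub_ne_zero.mpr hζ1)
    rw [hs] at hlim
    set e := Real.exp (-r ^ n)
    have key : ‖modulated n (r * ζ)‖ ≤ C * (e / r) := by
      -- The primitive vanishes at infinity, so its value at r is bounded by its variation on [r,
      -- t], with t → ∞.
      have h2 : Tendsto (fun t : ℝ => ‖modulated n (t * ζ) - modulated n (r * ζ)‖) atTop
          (𝓝 ‖0 - modulated n (r * ζ)‖) := (hlim.sub_const _).norm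
      rw [zero_sub, norm_neg] at h2
      refine le_of_tendsto h2 ?_
      filter_upwards [eventually_ge_atTop r] with t ht
      have := ray_comparison hn hC hl (z := modulated n (r * ζ)) (M := -C) (M₀ := C * (e / r))
        hr1 ht ?_ ?_
      · refine this.trans ?_
        have : 0 ≤ Real.exp (-((ζ ^ n).re * t ^ n)) / t :=
          div_nonneg (Real.exp_pos _).le (by linarith)
        nlinarith
      · intro u hu
        rw [hζ]
        simp only [Complex.one_re]
        nlinarith
      · rw [hζ, sub_self]
        simp [e]
    rw [norm_modulated, re_ray_pow, hζ] at key
    simp only [Complex.one_re, one_mul] at key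
    have he : 0 < e := Real.exp_pos _
    have hr0 : 0 < r := by linarith
    have h3 : e * ‖mittagLeffler n (r * ζ)‖ * r ≤ C * e := by
      calc _ ≤ C * (e / r) * r := by gcongr
        _ = _ := by field_simp
    nlinarith

/-! ### Upper and lower bounds in the central sector -/

/-- On a ray inside the central sector, the Mittag-Leffler function is `O(e^{Re w^n})`. -/
lemma exists_bound_growth_sector {n : ℕ} (hn : 1 ≤ n) {c : ℝ} (hc : 0 < c) :
    ∃ K, 0 ≤ K ∧ ∀ (l : ℂ) (r : ℝ), ‖l‖ = 1 → 0 ≤ r → c ≤ (l ^ n).re →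
      ‖mittagLeffler n (r * l)‖ ≤ K * Real.exp ((((r : ℂ) * l) ^ n).re) := by
  obtain ⟨C, hC0, hC⟩ := exists_forcing_bound n
  obtain ⟨A, hA0, hA⟩ := exists_norm_mittagLeffler_le n
  set A' := A * (1 + 1) ^ n * Real.exp (1 ^ n)
  have hA' : 0 ≤ A' := by positivity
  set M := C / c + A'
  have hM : 0 ≤ M := by positivity
  refine ⟨2 * M, by positivity, fun l r hl hr hρ => ?_⟩
  have small : ∀ r : ℝ, 0 ≤ r → r ≤ 1 → ‖modulated n (r * l)‖ ≤ A' := fun r hr hr1 => by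
    rw [norm_modulated, re_ray_pow]
    have h1 : Real.exp (-((l ^ n).re * r ^ n)) ≤ 1 := by
      rw [Real.exp_le_one_iff]
      have : 0 ≤ (l ^ n).re * r ^ n := by have : 0 ≤ (l ^ n).re := by linarith
                                          positivity
      linarith
    have h2 : ‖mittagLeffler n (r * l)‖ ≤ A' := by
      refine (hA _).trans ?_
      rw [norm_ray hl hr]
      show _ ≤ A * (1 + 1) ^ n * Real.exp (1 ^ n)
      gcongr
    calc _ ≤ 1 * A' := by gcongr
      _ = A' := one_mul _
  have key : ‖modulated n (r * l)‖ ≤ 2 * M := by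
    have hAM : A' ≤ M := by have : 0 ≤ C / c := by positivity
                            simp only [M]; linarith
    rcases le_total r 1 with hr1 | hr1
    · linarith [small r hr hr1]
    -- Here e^{-ρ t^n}/t decreases, so the majorant 2M - M e^{-ρ t^n}/t increases and never exceeds
    -- 2M.
    · have := ray_comparison hn hC hl (z := 0) (M := -M) (M₀ := 2 * M) le_rfl hr1 ?_ ?_
      · rw [sub_zero] at this
        have h1 : 0 ≤ M * (Real.exp (-((l ^ n).re * r ^ n)) / r) := by positivity
        linarith
      · intro t ht
        have ht0 : 0 ≤ (n : ℝ) * t ^ n := by positivity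
        have h4 : C ≤ M * c := by
          have : C / c * c = C := by field_simp
          have : 0 ≤ A' * c := by positivity
          simp only [M]; linarith
        have h5 : M * c ≤ M * (l ^ n).re := by gcongr
        nlinarith
      · have h1 : Real.exp (-((l ^ n).re * 1 ^ n)) ≤ 1 := by
          rw [Real.exp_le_one_iff]; simp; linarith
        have h2 := small 1 zero_le_one le_rfl
        rw [sub_zero]
        simp only [one_pow, mul_one, div_one] at h1 ⊢
        nlinarith
  rw [norm_mittagLeffler_eq, mul_comm]
  gcongr

/-- In a strict subsector of the central sector, the Mittag-Leffler function is eventually at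
least a multiple of `e^{Re w^n}`. -/
lemma exists_lower_bound_sector {n : ℕ} (hn : 1 ≤ n) {θ₁ : ℝ} (hθ1 : n * θ₁ < π / 2) :
    ∃ r₀ : ℝ, ∀ r θ : ℝ, r₀ ≤ r → |θ| ≤ θ₁ →
      Real.exp ((((r : ℂ) * Complex.exp (θ * Complex.I)) ^ n).re) / 4 ≤
        ‖mittagLeffler n (r * Complex.exp (θ * Complex.I))‖ := by
  obtain ⟨C, hC0, hC⟩ := exists_forcing_bound n
  rcases lt_or_ge θ₁ 0 with h0 | hθ0
  · exact ⟨0, fun r θ _ h => absurd (abs_nonneg θ) (by linarith)⟩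
  set c := Real.cos (n * θ₁)
  have hc : 0 < c := Real.cos_pos_of_mem_Ioo ⟨by have : 0 ≤ n * θ₁ := by positivity
                                                 linarith [Real.pi_pos], hθ1⟩
  -- On the positive axis the limit is n ≥ 1. Turning along the arc of radius r up to angle θ₁
  -- changes `modulated` by at most a multiple of r^n e^{-c r^n}, eventually at most 1/4, so 1/4
  -- remains.
  have hlim : ∀ᶠ r : ℝ in atTop, 1 / 2 ≤ ‖modulated n (r * 1)‖ := by
    have h := (tendsto_modulated_ray hn (one_pow n)).norm
    have : ‖∑ j ∈ range n, (1 : ℂ) ^ j‖ = n := by simp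
    rw [this] at h
    have hn' : (1 : ℝ) ≤ n := by exact_mod_cast hn
    exact h.eventually_const_le (by linarith)
  have hsmall : ∀ᶠ r : ℝ in atTop, n * C * θ₁ * (r ^ n * Real.exp (-(c * r ^ n))) ≤ 1 / 4 := by
    have h1 : Tendsto (fun x : ℝ => x * Real.exp (-(c * x))) atTop (𝓝 0) := by
      have := tendsto_rpow_mul_exp_neg_mul_atTop_nhds_zero 1 c hc
      simpa using this
    have h2 := (h1.comp (tendsto_pow_atTop (α := ℝ) (by omega : n ≠ 0))).const_mul (n * C * θ₁)
    rw [mul_zero] at h2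
    exact h2.eventually_le_const (by norm_num)
  obtain ⟨r₀, hr₀⟩ := ((hlim.and hsmall).and (eventually_ge_atTop 1)).exists_forall_of_atTop
  refine ⟨r₀, fun r θ hr hθ => ?_⟩
  obtain ⟨⟨h1, h2⟩, h3⟩ := hr₀ r hr
  have hr0 : 0 < r := by linarith
  have hnorm : ∀ τ : ℝ, ‖(r : ℂ) * Complex.exp (τ * Complex.I)‖ = r := fun τ =>
    norm_ray (Complex.norm_exp_ofReal_mul_I τ) hr0.le
  have hre : ∀ τ : ℝ, (((r : ℂ) * Complex.exp (τ * Complex.I)) ^ n).re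
      = Real.cos (n * τ) * r ^ n := fun τ => by
    rw [re_ray_pow, ← Complex.exp_nat_mul, ← mul_assoc]
    congr 1
    rw [← Complex.ofReal_natCast, ← Complex.ofReal_mul, Complex.exp_ofReal_mul_I_re]
  have hder : ∀ τ : ℝ, HasDerivAt
      (fun τ : ℝ => modulated n (r * Complex.exp (τ * Complex.I)))
      (n * Complex.exp (-(r * Complex.exp (τ * Complex.I)) ^ n) *
        forcing n (r * Complex.exp (τ * Complex.I)) *
          (r * (Complex.exp (τ * Complex.I) * Complex.I))) τ := fun τ => by
    have h := ((Complex.ofRealCLM.hasDerivAt (x := τ)).mul_const Complex.I).cexp.const_mul (r : ℂ)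
    exact (hasDerivAt_modulated hn _).comp τ (h.congr_deriv (by simp))
  have hbd : ∀ τ ∈ Set.Icc (-θ₁) θ₁,
      ‖n * Complex.exp (-(r * Complex.exp (τ * Complex.I)) ^ n) *
        forcing n (r * Complex.exp (τ * Complex.I)) *
          (r * (Complex.exp (τ * Complex.I) * Complex.I))‖ ≤
      n * C * (r ^ n * Real.exp (-(c * r ^ n))) := fun τ hτ => by
    rw [norm_mul _ (r * (Complex.exp (τ * Complex.I) * Complex.I)), ← mul_assoc (r : ℂ),
      norm_mul _ Complex.I, hnorm, Complex.norm_I, mul_one]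
    have h4 := norm_modulated_deriv_le hC (w := r * Complex.exp (τ * Complex.I))
      (by rw [hnorm]; exact h3)
    rw [hnorm, hre] at h4
    have h5 : c ≤ Real.cos (n * τ) := by
      rw [← Real.cos_abs (n * τ)]
      refine Real.cos_le_cos_of_nonneg_of_le_pi (abs_nonneg _) (by linarith [Real.pi_pos]) ?_
      rw [abs_mul, Nat.abs_cast]
      gcongr
      exact abs_le.mpr hτ
    calc _ ≤ n * C * r ^ n / r ^ 2 * Real.exp (-(Real.cos (n * τ) * r ^ n)) * r := by gcongr
      _ = n * C * r ^ n * Real.exp (-(Real.cos (n * τ) * r ^ n)) / r := by field_simp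
      _ ≤ n * C * r ^ n * Real.exp (-(Real.cos (n * τ) * r ^ n)) :=
        div_le_self (by positivity) h3
      _ ≤ n * C * r ^ n * Real.exp (-(c * r ^ n)) := by gcongr
      _ = _ := by ring
  have hmv := (convex_Icc (-θ₁) θ₁).norm_image_sub_le_of_norm_hasDerivWithin_le
    (x := 0) (y := θ) (fun τ _ => (hder τ).hasDerivWithinAt) hbd ⟨by linarith, hθ0⟩ (abs_le.mp hθ)
  have h6 : n * C * (r ^ n * Real.exp (-(c * r ^ n))) * ‖θ - 0‖ ≤ 1 / 4 := by
    rw [sub_zero, Real.norm_eq_abs]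
    calc _ ≤ n * C * (r ^ n * Real.exp (-(c * r ^ n))) * θ₁ := by gcongr
      _ ≤ _ := by linarith
  have h7 : 1 / 4 ≤ ‖modulated n (r * Complex.exp (θ * Complex.I))‖ := by
    have h8 := norm_sub_norm_le (modulated n (r * 1))
      (modulated n (r * Complex.exp (θ * Complex.I)))
    rw [norm_sub_rev] at h8
    simp only [Complex.ofReal_zero, zero_mul, Complex.exp_zero] at hmv
    linarith
  rw [norm_mittagLeffler_eq, div_eq_mul_one_div]
  gcongr

/-! ### Decay outside the central sector -/

/-- Phragmén–Lindelöf for `w E(w)` in a sector of opening less than `π / n`. -/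
lemma mul_norm_mittagLeffler_le_of_sector {n : ℕ} (hn : 1 ≤ n) {a b K : ℝ} (hab : a < b)
    (hlt : n * (b - a) < π)
    (ha : ∀ r : ℝ, 0 ≤ r → r * ‖mittagLeffler n (r * Complex.exp (a * Complex.I))‖ ≤ K)
    (hb : ∀ r : ℝ, 0 ≤ r → r * ‖mittagLeffler n (r * Complex.exp (b * Complex.I))‖ ≤ K)
    {θ : ℝ} (hθa : a ≤ θ) (hθb : θ ≤ b) {r : ℝ} (hr : 0 ≤ r) :
    r * ‖mittagLeffler n (r * Complex.exp (θ * Complex.I))‖ ≤ K := by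
  rcases hr.eq_or_lt with rfl | hr0
  · simpa using ha 0 le_rfl
  -- The substitution w = e^ζ turns the sector into the horizontal strip a ≤ Im ζ ≤ b.
  set f : ℂ → ℂ := fun ζ => Complex.exp ζ * mittagLeffler n (Complex.exp ζ)
  have hfn : ∀ ζ : ℂ, ‖f ζ‖ =
      Real.exp ζ.re * ‖mittagLeffler n ((Real.exp ζ.re : ℝ) * Complex.exp (ζ.im * Complex.I))‖ := by
    intro ζ
    simp only [f]
    rw [norm_mul, Complex.norm_exp]
    congr 3
    rw [Complex.ofReal_exp, ← Complex.exp_add, Complex.re_add_im]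
  have hfd : Differentiable ℂ f :=
    Complex.differentiable_exp.mul ((differentiable_mittagLeffler hn).comp Complex.differentiable_exp)
  have key := PhragmenLindelof.horizontal_strip (f := f) (C := K) (a := a) (b := b)
    (z := Real.log r + θ * Complex.I) hfd.diffContOnCl ?_ ?_ ?_ (by simpa using hθa)
    (by simpa using hθb)
  · rw [hfn] at key
    simpa [Real.exp_log hr0] using key
  · obtain ⟨A, hA0, hA⟩ := exists_norm_mittagLeffler_le n
    -- E has order n, below the critical order π/(b - a). With X = e^{|Re ζ|} the constant n + 2
    -- comes from X^{n+1} e^{X^n} ≤ e^{(n+2) X^n}.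
    refine ⟨n, by rw [lt_div_iff₀ (by linarith)]; exact hlt, n + 2,
      Asymptotics.IsBigO.of_bound (A * 2 ^ n) (Eventually.of_forall fun ζ => ?_)⟩
    simp only [f]
    rw [norm_mul, Real.norm_of_nonneg (Real.exp_pos _).le]
    refine (mul_le_mul_of_nonneg_left (hA _) (norm_nonneg _)).trans ?_
    rw [Complex.norm_exp]
    set X := Real.exp |ζ.re|
    have hX : Real.exp ζ.re ≤ X := Real.exp_le_exp.mpr (le_abs_self _)
    have hX1 : 1 ≤ X := Real.one_le_exp (abs_nonneg _)
    have hXn : Real.exp (n * |ζ.re|) = X ^ n := by rw [Real.exp_nat_mul]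
    rw [hXn]
    have h1 : X ≤ Real.exp (X ^ n) :=
      (le_self_pow₀ (n := n) hX1 (by omega)).trans (by linarith [Real.add_one_le_exp (X ^ n)])
    calc Real.exp ζ.re * (A * (1 + Real.exp ζ.re) ^ n * Real.exp (Real.exp ζ.re ^ n))
        ≤ X * (A * (X + X) ^ n * Real.exp (X ^ n)) := by gcongr
      _ = A * 2 ^ n * (X ^ (n + 1) * Real.exp (X ^ n)) := by rw [← two_mul, mul_pow]; ring
      _ ≤ A * 2 ^ n * (Real.exp (X ^ n) ^ (n + 1) * Real.exp (X ^ n)) := by gcongr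
      _ = _ := by
        rw [← pow_succ, ← Real.exp_nat_mul]; push_cast; ring_nf
  · intro ζ hζ
    rw [hfn, hζ]
    exact ha _ (Real.exp_pos _).le
  · intro ζ hζ
    rw [hfn, hζ]
    exact hb _ (Real.exp_pos _).le

lemma exp_mul_I_pow_re (n : ℕ) (θ : ℝ) : (Complex.exp (θ * Complex.I) ^ n).re = Real.cos (n * θ) := by
  rw [← Complex.exp_nat_mul, ← mul_assoc, ← Complex.ofReal_natCast, ← Complex.ofReal_mul,
    Complex.exp_ofReal_mul_I_re]

lemma exp_root_pow {n : ℕ} (hn : 1 ≤ n) (l : ℤ) :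
    Complex.exp (((2 * π * l / n : ℝ) : ℂ) * Complex.I) ^ n = 1 := by
  have hn0 : (n : ℂ) ≠ 0 := by exact_mod_cast (by omega : n ≠ 0)
  rw [← Complex.exp_nat_mul, Complex.exp_eq_one_iff]
  refine ⟨l, ?_⟩
  push_cast
  field_simp

lemma exp_root_ne_one {n : ℕ} (hn : 1 ≤ n) {l : ℤ} (hl : |l| < n) (hl0 : l ≠ 0) :
    Complex.exp (((2 * π * l / n : ℝ) : ℂ) * Complex.I) ≠ 1 := by
  have hn0 : (n : ℝ) ≠ 0 := by exact_mod_cast (by omega : n ≠ 0)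
  intro h
  obtain ⟨m, hm⟩ := Complex.exp_eq_one_iff.mp h
  have h1 := congrArg Complex.im hm
  simp only [Complex.mul_im, Complex.ofReal_re, Complex.ofReal_im, Complex.I_re, Complex.I_im,
    Complex.intCast_re, Complex.intCast_im, Complex.mul_re, Complex.re_ofNat, Complex.im_ofNat] at h1
  have h2 : (l : ℝ) = m * n := by
    have := Real.pi_pos
    field_simp at h1
    nlinarith
  have h3 : l = m * n := by exact_mod_cast h2
  have hm0 : m ≠ 0 := by rintro rfl; simp at h3; exact hl0 h3
  have : (1 : ℤ) ≤ |m| := Int.one_le_abs hm0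
  rw [h3, abs_mul, Nat.abs_cast] at hl
  nlinarith

/-- Outside a sector slightly larger than `|arg w| ≤ π / (2n)`, the Mittag-Leffler function is
`O(1 / |w|)`. -/
theorem exists_bound_outside_sector {n : ℕ} (hn : 1 ≤ n) {c : ℝ} (hc : c < Real.cos (π / (2 * n))) :
    ∃ K, 0 ≤ K ∧ ∀ w : ℂ, w.re ≤ c * ‖w‖ → (1 + ‖w‖) * ‖mittagLeffler n w‖ ≤ K := by
  have hpi := Real.pi_pos
  have hn1 : (1 : ℝ) ≤ n := by exact_mod_cast hn
  wlog hc1 : -1 ≤ c generalizing c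
  · obtain ⟨K, hK0, hK⟩ := this (c := -1) (by
      have : 0 ≤ Real.cos (π / (2 * n)) := Real.cos_nonneg_of_mem_Icc
        ⟨by have : 0 ≤ π / (2 * n) := by positivity
            linarith, by gcongr; linarith⟩
      linarith) le_rfl
    exact ⟨K, hK0, fun w hw => hK w (by nlinarith [norm_nonneg w])⟩
  set θ₁ := Real.arccos c
  have hθ₁ : π / (2 * n) < θ₁ := by
    have h1 : Real.arccos (Real.cos (π / (2 * n))) = π / (2 * n) :=
      Real.arccos_cos (by positivity) (by rw [div_le_iff₀ (by positivity)]; nlinarith)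
    rw [← h1]
    exact Real.arccos_lt_arccos hc1 hc (Real.cos_le_one _)
  have hnθ₁ : π / 2 < n * θ₁ := by
    calc π / 2 = n * (π / (2 * n)) := by field_simp
      _ < _ := by gcongr
  -- κ is the angular margin, after multiplication by n, beyond the critical angle π/2; the cap π/4
  -- keeps π/2 + κ below π.
  set κ := min (n * θ₁ - π / 2) (π / 4)
  have hκ0 : 0 < κ := lt_min (by linarith) (by linarith)
  have hκ1 : κ ≤ n * θ₁ - π / 2 := min_le_left _ _
  have hκ2 : κ ≤ π / 4 := min_le_right _ _
  have hsin : 0 < Real.sin κ := Real.sin_pos_of_pos_of_lt_pi hκ0 (by linarith)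
  have hcosκ : Real.cos (π / 2 + κ) = -Real.sin κ := by
    rw [add_comm, Real.cos_add_pi_div_two]
  obtain ⟨K₁, hK₁⟩ := exists_bound_decay_wedge hn hsin
  obtain ⟨K₂, hK₂⟩ := exists_bound_root_ray hn
  obtain ⟨A, hA0, hA⟩ := exists_norm_mittagLeffler_le n
  set A' := A * (1 + 1) ^ n * Real.exp (1 ^ n)
  set K := max K₁ K₂
  have wedge : ∀ θ r : ℝ, 0 ≤ r → Real.cos (n * θ) ≤ -Real.sin κ →
      r * ‖mittagLeffler n (r * Complex.exp (θ * Complex.I))‖ ≤ K := fun θ r hr h =>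
    (hK₁ _ r (Complex.norm_exp_ofReal_mul_I θ) hr (by rwa [exp_mul_I_pow_re])).trans
      (le_max_left _ _)
  have main : ∀ w : ℂ, w ≠ 0 → w.re ≤ c * ‖w‖ → ‖w‖ * ‖mittagLeffler n w‖ ≤ K := by
    intro w hw0 hw
    set θ := Complex.arg w
    have hpol : w = (‖w‖ : ℂ) * Complex.exp (θ * Complex.I) :=
      (Complex.norm_mul_exp_arg_mul_I w).symm
    have hwpos : 0 < ‖w‖ := norm_pos_iff.mpr hw0
    have hθ : θ₁ ≤ |θ| := by
      have h1 : Real.cos |θ| ≤ c := by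
        rw [Real.cos_abs, Complex.cos_arg hw0, div_le_iff₀ hwpos]
        exact hw
      rw [← Real.arccos_cos (abs_nonneg θ) (Complex.abs_arg_le_pi w)]
      exact Real.arccos_le_arccos h1
    have hφ : π / 2 + κ ≤ |n * θ| := by
      rw [abs_mul, Nat.abs_cast]
      have : n * θ₁ ≤ n * |θ| := by gcongr
      linarith
    rw [hpol, norm_ray (Complex.norm_exp_ofReal_mul_I θ) hwpos.le]
    -- 2πl/n is the root direction nearest to arg w, and u is the remaining angle of w^n, reduced to
    -- [-π, π].
    set l := round (n * θ / (2 * π))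
    set u := n * θ - 2 * π * l
    have hu : |u| ≤ π := by
      have h1 := abs_sub_round (n * θ / (2 * π))
      have h2 : u = 2 * π * (n * θ / (2 * π) - l) := by
        simp only [u]; field_simp
      rw [h2, abs_mul, abs_of_pos (by positivity : 0 < 2 * π)]
      nlinarith
    -- Either w lies in a decay wedge, or between the root ray l and the edge of such a wedge, a
    -- sector of opening (π/2 + κ)/n < π/n. In the second case l ≠ 0, because w is outside the
    -- central sector, so the root ray is one of decay.
    by_cases hu2 : π / 2 + κ ≤ |u|
    · refine wedge θ _ hwpos.le ?_
      have : Real.cos (n * θ) = Real.cos |u| := by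
        rw [Real.cos_abs, ← Real.cos_sub_int_mul_two_pi (n * θ) l]
        simp only [u]; ring_nf
      rw [this, ← hcosκ]
      exact Real.cos_le_cos_of_nonneg_of_le_pi (by linarith) hu hu2
    · push Not at hu2
      have hl0 : l ≠ 0 := by
        intro h
        simp only [u, h, Int.cast_zero, mul_zero, sub_zero] at hu2
        linarith
      have hl : |l| < n := by
        have h1 : 2 * π * |(l : ℝ)| ≤ |n * θ| + |u| := by
          have : 2 * π * l = n * θ - u := by simp only [u]; ring
          rw [← abs_of_pos (by positivity : 0 < 2 * π), ← abs_mul, this]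
          exact abs_sub _ _
        have h2 : |n * θ| ≤ n * π := by
          rw [abs_mul, Nat.abs_cast]
          gcongr
          exact Complex.abs_arg_le_pi w
        have h3 : |(l : ℝ)| < n := by nlinarith
        exact_mod_cast h3
      set α : ℝ := 2 * π * l / n
      have hα : n * α = 2 * π * l := by simp only [α]; field_simp
      have root : ∀ r : ℝ, 0 ≤ r → r * ‖mittagLeffler n (r * Complex.exp (α * Complex.I))‖ ≤ K :=
        fun r hr => (hK₂ _ r (exp_root_pow hn l) (exp_root_ne_one hn hl hl0) hr).trans
          (le_max_right _ _)
      have hab := abs_lt.mp hu2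
      have hw' : (π / 2 + κ) / n * n = π / 2 + κ := by field_simp
      have hpos : 0 < (π / 2 + κ) / n := by positivity
      rcases le_total 0 u with hu0 | hu0
      · refine mul_norm_mittagLeffler_le_of_sector hn (a := α) (b := α + (π / 2 + κ) / n)
          (by linarith) (by nlinarith) root (fun r hr => wedge _ r hr ?_) ?_ ?_ hwpos.le
        · rw [mul_add, hα, mul_comm (n : ℝ) ((π / 2 + κ) / n), hw', ← hcosκ]
          have := Real.cos_add_int_mul_two_pi (π / 2 + κ) l
          rw [← this]; ring_nf; rfl
        · refine le_of_mul_le_mul_left ?_ (by linarith : (0 : ℝ) < n)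
          rw [hα]; simp only [u] at hu0; linarith
        · refine le_of_mul_le_mul_left ?_ (by linarith : (0 : ℝ) < n)
          rw [mul_add, hα, mul_comm (n : ℝ) ((π / 2 + κ) / n), hw']
          simp only [u] at hab; linarith
      · refine mul_norm_mittagLeffler_le_of_sector hn (a := α - (π / 2 + κ) / n) (b := α)
          (by linarith) (by nlinarith) (fun r hr => wedge _ r hr ?_) root ?_ ?_ hwpos.le
        · rw [mul_sub, hα, mul_comm (n : ℝ) ((π / 2 + κ) / n), hw', ← hcosκ, ← Real.cos_neg]
          have := Real.cos_sub_int_mul_two_pi (π / 2 + κ) l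
          rw [← this]; ring_nf; rfl
        · refine le_of_mul_le_mul_left ?_ (by linarith : (0 : ℝ) < n)
          rw [mul_sub, hα, mul_comm (n : ℝ) ((π / 2 + κ) / n), hw']
          simp only [u] at hab; linarith
        · refine le_of_mul_le_mul_left ?_ (by linarith : (0 : ℝ) < n)
          rw [hα]; simp only [u] at hu0; linarith
  have hA' : 0 ≤ A' := by positivity
  refine ⟨max (2 * A') (2 * K), le_max_of_le_left (by positivity), fun w hw => ?_⟩
  rcases le_total ‖w‖ 1 with h1 | h1
  · refine le_max_of_le_left ?_
    have h2 : ‖mittagLeffler n w‖ ≤ A' := by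
      refine (hA w).trans ?_
      show _ ≤ A * (1 + 1) ^ n * Real.exp (1 ^ n)
      gcongr
    calc _ ≤ (1 + 1) * A' := by gcongr
      _ = _ := by ring
  · refine le_max_of_le_right ?_
    have := main w (norm_pos_iff.mp (by linarith)) hw
    nlinarith [norm_nonneg (mittagLeffler n w)]

/-! ### The truncation error -/

/-- The truncated Mittag-Leffler series `∑_{m ≤ nN} w^m / Γ(m/n + 1)`. -/
def truncated (n N : ℕ) (w : ℂ) : ℂ :=
  ∑ m ∈ range (n * N + 1), ((Real.Gamma ((m : ℝ) / n + 1))⁻¹ : ℝ) * w ^ m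

/-- Write m = nM + j. The indices m < nN form complete blocks M < N, and m = nN is left over with
coefficient 1/N!. -/
lemma truncated_eq {n : ℕ} (hn : 1 ≤ n) (N : ℕ) (w : ℂ) :
    truncated n N w = ∑ j ∈ range n, w ^ j * ∑ M ∈ range N,
      (gammaCoeff ((j : ℝ) / n) M : ℂ) * (w ^ n) ^ M + (gammaCoeff 0 N : ℂ) * (w ^ n) ^ N := by
  have hn0 : (n : ℝ) ≠ 0 := by exact_mod_cast (by omega : n ≠ 0)
  rw [truncated, sum_range_succ]
  congr 1
  · induction N with
    | zero => simp
    | succ N ih =>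
      rw [mul_add, mul_one, sum_range_add, ih, ← sum_add_distrib]
      refine sum_congr rfl fun j _ => ?_
      rw [sum_range_succ, mul_add]
      congr 1
      have : (((n * N + j : ℕ) : ℝ)) / n = N + (j : ℝ) / n := by
        push_cast; field_simp
      rw [this, gammaCoeff, ← pow_mul, pow_add]
      ring
  · have : (((n * N : ℕ) : ℝ)) / n = N + 0 := by push_cast; field_simp; ring
    rw [this, gammaCoeff, ← pow_mul]

/-- (m+N)! ≥ m! N!, so ‖x‖^N/N! factors out of the tail and an exponential series is left. -/
lemma norm_tail_gammaSeries_le {a : ℝ} (ha : 0 ≤ a) (x : ℂ) (N : ℕ) :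
    ‖gammaSeries a x - ∑ M ∈ range N, (gammaCoeff a M : ℂ) * x ^ M‖ ≤
      (Real.Gamma (a + 1))⁻¹ * (‖x‖ ^ N / N.factorial * Real.exp ‖x‖) := by
  have hG : 0 ≤ (Real.Gamma (a + 1))⁻¹ :=
    inv_nonneg.mpr (Real.Gamma_pos_of_pos (by positivity)).le
  rw [gammaSeries, ← (summable_gammaSeries ha x).sum_add_tsum_nat_add N, add_sub_cancel_left]
  have h : HasSum (fun m : ℕ => (Real.Gamma (a + 1))⁻¹ * (‖x‖ ^ N / N.factorial *
      (‖x‖ ^ m / m.factorial)))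
      ((Real.Gamma (a + 1))⁻¹ * (‖x‖ ^ N / N.factorial * Real.exp ‖x‖)) := by
    have := NormedSpace.expSeries_div_hasSum_exp (𝔸 := ℝ) ‖x‖
    rw [← Real.exp_eq_exp_ℝ] at this
    exact (this.mul_left _).mul_left _
  refine tsum_of_norm_bounded h fun m => ?_
  rw [norm_mul, norm_pow]
  have hf : (N.factorial : ℝ) * m.factorial ≤ (m + N).factorial := by
    rw [mul_comm]; exact_mod_cast Nat.le_of_dvd (Nat.factorial_pos _) (Nat.factorial_mul_factorial_dvd_factorial_add m N)
  have hN := N.factorial_pos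
  have hm := m.factorial_pos
  calc _ ≤ (Real.Gamma (a + 1))⁻¹ / (m + N).factorial * ‖x‖ ^ (m + N) := by
        gcongr; exact norm_gammaCoeff_le ha _
    _ ≤ (Real.Gamma (a + 1))⁻¹ / (N.factorial * m.factorial) * ‖x‖ ^ (m + N) := by
        gcongr
    _ = _ := by rw [pow_add]; field_simp

lemma exists_truncation_bound {n : ℕ} (hn : 1 ≤ n) :
    ∃ B, 0 ≤ B ∧ ∀ (N : ℕ) (w : ℂ), ‖truncated n N w - mittagLeffler n w‖ ≤
      B * (1 + ‖w‖ ^ n) * ((‖w‖ ^ n) ^ N / N.factorial * Real.exp (‖w‖ ^ n)) := by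
  set A := ∑ j ∈ range n, (Real.Gamma ((j : ℝ) / n + 1))⁻¹
  have hA : 0 ≤ A :=
    sum_nonneg fun j _ => inv_nonneg.mpr (Real.Gamma_pos_of_pos (by positivity)).le
  -- The summand 1 pays for the leftover term m = nN.
  refine ⟨A * 2 ^ n + 1, by positivity, fun N w => ?_⟩
  set T := (‖w‖ ^ n) ^ N / N.factorial * Real.exp (‖w‖ ^ n)
  have hT : 0 ≤ T := by positivity
  have hpow : ∀ j ∈ range n, ‖w‖ ^ j ≤ 2 ^ n * (1 + ‖w‖ ^ n) := fun j hj => by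
    have h2 : (1 : ℝ) ≤ 2 ^ n := one_le_pow₀ (by norm_num)
    have h3 : ‖w‖ ^ j ≤ 1 + ‖w‖ ^ n := by
      rcases le_total ‖w‖ 1 with h | h
      · have := pow_le_one₀ (n := j) (norm_nonneg w) h
        have : 0 ≤ ‖w‖ ^ n := by positivity
        linarith
      · have := pow_le_pow_right₀ h (mem_range.mp hj).le
        linarith
    have : 0 ≤ ‖w‖ ^ n := by positivity
    nlinarith
  rw [truncated_eq hn, mittagLeffler, norm_sub_rev, ← sub_sub, ← sum_sub_distrib]
  refine (norm_sub_le _ _).trans ?_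
  have h1 : ‖∑ j ∈ range n, (w ^ j * gammaSeries ((j : ℝ) / n) (w ^ n) -
      w ^ j * ∑ M ∈ range N, (gammaCoeff ((j : ℝ) / n) M : ℂ) * (w ^ n) ^ M)‖ ≤
      A * 2 ^ n * (1 + ‖w‖ ^ n) * T := by
    refine (norm_sum_le _ _).trans ?_
    simp only [A, sum_mul]
    refine sum_le_sum fun j hj => ?_
    rw [← mul_sub, norm_mul, norm_pow]
    have h := norm_tail_gammaSeries_le (a := (j : ℝ) / n) (by positivity) (w ^ n) N
    rw [norm_pow] at h
    calc _ ≤ 2 ^ n * (1 + ‖w‖ ^ n) * ((Real.Gamma ((j : ℝ) / n + 1))⁻¹ * T) := by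
          gcongr
          exact hpow j hj
      _ = _ := by ring
  have h2 : ‖(gammaCoeff 0 N : ℂ) * (w ^ n) ^ N‖ ≤ T := by
    rw [norm_mul, norm_pow, norm_pow]
    have h := norm_gammaCoeff_le le_rfl N
    simp only [zero_add, Real.Gamma_one, inv_one] at h
    have h3 : 1 ≤ Real.exp (‖w‖ ^ n) := Real.one_le_exp (by positivity)
    calc _ ≤ 1 / N.factorial * (‖w‖ ^ n) ^ N := by gcongr
      _ = (‖w‖ ^ n) ^ N / N.factorial * 1 := by ring
      _ ≤ _ := by simp only [T]; gcongr
  have h4 : T ≤ (1 + ‖w‖ ^ n) * T := by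
    have : 0 ≤ ‖w‖ ^ n := by positivity
    nlinarith
  nlinarith

/-- Truncation at order `nN` is harmless on the disc `|w|^n ≤ Y N` when `Y N ~ γ N / e` with
`γ e^{γ/e} < 1`. -/
theorem exists_truncation_error {n : ℕ} (hn : 1 ≤ n) {γ₀ γ : ℝ}
    (hγ₀eq : Real.log γ₀ + γ₀ / Real.exp 1 = 0) (hγ : 0 < γ) (hγγ₀ : γ < γ₀) {Y : ℕ → ℝ}
    (hY : (fun N : ℕ => Y N - γ / Real.exp 1 * N) =O[atTop] (fun _ : ℕ => (1 : ℝ))) :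
    ∃ ε : ℕ → ℝ, Tendsto ε atTop (𝓝 0) ∧ (∀ N, 0 ≤ ε N) ∧
      ∀ᶠ N in atTop, ∀ w : ℂ, ‖w‖ ^ n ≤ Y N → ‖truncated n N w - mittagLeffler n w‖ ≤ ε N := by
  obtain ⟨B, hB0, hB⟩ := exists_truncation_bound hn
  -- The gap between γ and γ₁ absorbs the O(1) in the hypothesis on Y, and γ₁ < γ₀ still makes ρ <
  -- 1.
  obtain ⟨γ₁, h1, h2⟩ := exists_between hγγ₀
  have hγ₁ : 0 < γ₁ := hγ.trans h1
  set ρ := γ₁ * Real.exp (γ₁ / Real.exp 1)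
  have he : 0 < Real.exp 1 := Real.exp_pos 1
  have hρ0 : 0 < ρ := by positivity
  have hρ1 : ρ < 1 := by
    rw [← Real.log_neg_iff hρ0, Real.log_mul hγ₁.ne' (Real.exp_pos _).ne', Real.log_exp]
    have h3 := Real.log_lt_log hγ₁ h2
    have h4 : γ₁ / Real.exp 1 < γ₀ / Real.exp 1 := by gcongr
    linarith
  refine ⟨fun N => B * ((1 + γ₁ / Real.exp 1 * N) * ρ ^ N), ?_, fun N => by positivity, ?_⟩
  · have h3 := tendsto_pow_atTop_nhds_zero_of_lt_one hρ0.le hρ1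
    have h4 := tendsto_self_mul_const_pow_of_lt_one hρ0.le hρ1
    have := (h3.add (h4.const_mul (γ₁ / Real.exp 1))).const_mul B
    simp only [mul_zero, add_zero] at this
    exact this.congr fun N => by ring
  · obtain ⟨C, hC⟩ := hY.bound
    have hlin : ∀ᶠ N : ℕ in atTop, C ≤ (γ₁ - γ) / Real.exp 1 * N :=
      (tendsto_natCast_atTop_atTop.const_mul_atTop (div_pos (by linarith) he)).eventually_ge_atTop C
    filter_upwards [hC, hlin, eventually_ge_atTop 1] with N h3 h4 hN w hw
    have hN0 : (0 : ℝ) < N := by exact_mod_cast hN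
    have hX : ‖w‖ ^ n ≤ γ₁ / Real.exp 1 * N := by
      simp only [Real.norm_eq_abs, abs_one, mul_one] at h3
      have := (abs_le.mp h3).2
      have h5 : (γ₁ - γ) / Real.exp 1 * N = γ₁ / Real.exp 1 * N - γ / Real.exp 1 * N := by ring
      linarith
    refine (hB N w).trans ?_
    rw [mul_assoc]
    -- N^N/N! ≤ e^N cancels the factor e^{-N} in (γ₁N/e)^N.
    have hfac := Real.pow_div_factorial_le_exp (N : ℝ) hN0.le N
    set X := ‖w‖ ^ n
    have hX0 : 0 ≤ X := by positivity
    have h6 : X ^ N / N.factorial * Real.exp X ≤ ρ ^ N := by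
      have e1 : X ^ N / N.factorial ≤ γ₁ ^ N := by
        calc X ^ N / N.factorial ≤ (γ₁ / Real.exp 1 * N) ^ N / N.factorial := by gcongr
          _ = (γ₁ / Real.exp 1) ^ N * ((N : ℝ) ^ N / N.factorial) := by rw [mul_pow]; ring
          _ ≤ (γ₁ / Real.exp 1) ^ N * Real.exp N := by gcongr
          _ = _ := by
            rw [div_pow, ← Real.exp_nat_mul, mul_one]
            field_simp
      have e2 : Real.exp X ≤ Real.exp (γ₁ / Real.exp 1) ^ N := by
        rw [← Real.exp_nat_mul]
        gcongr
        linarith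
      calc _ ≤ γ₁ ^ N * Real.exp (γ₁ / Real.exp 1) ^ N := by gcongr
        _ = _ := by rw [← mul_pow]
    gcongr

/-! ### Normalized Bessel functions and their integral formulas -/

lemma hasSum_intervalIntegral_of_norm_le {F : ℕ → ℝ → ℂ} {f : ℝ → ℂ} {u : ℕ → ℝ} {a b : ℝ}
    (hab : a ≤ b) (hF : ∀ j, Continuous (F j)) (hu : Summable u)
    (hb : ∀ j, ∀ t ∈ Set.Icc a b, ‖F j t‖ ≤ u j)
    (hs : ∀ t ∈ Set.Icc a b, HasSum (fun j => F j t) (f t)) :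
    HasSum (fun j => ∫ t in a..b, F j t) (∫ t in a..b, f t) := by
  have hI : ∀ t, t ∈ Set.uIoc a b → t ∈ Set.Icc a b := fun t ht => by
    rw [Set.uIoc_of_le hab] at ht
    exact ⟨ht.1.le, ht.2⟩
  exact intervalIntegral.hasSum_integral_of_dominated_convergence (fun j _ => u j)
    (fun j => (hF j).aestronglyMeasurable)
    (fun j => Eventually.of_forall fun t ht => hb j t (hI t ht))
    (Eventually.of_forall fun t _ => hu) intervalIntegrable_const
    (Eventually.of_forall fun t ht => hs t (hI t ht))

/-- The coefficients of `∑ (-q)^j m! / ((m+j)! j!)`. -/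
def besselCoeff (m j : ℕ) : ℂ := (-1) ^ j * m.factorial / ((m + j).factorial * j.factorial)

lemma norm_besselCoeff_le (m j : ℕ) : ‖besselCoeff m j‖ ≤ 1 / j.factorial := by
  have h1 : (m.factorial : ℝ) ≤ (m + j).factorial := by
    exact_mod_cast Nat.factorial_le (Nat.le_add_right _ _)
  have h2 := (m + j).factorial_pos
  have h3 := j.factorial_pos
  simp only [besselCoeff, norm_mul, norm_div, norm_pow, norm_neg, norm_one, one_pow, one_mul,
    Complex.norm_natCast]
  rw [div_le_div_iff₀ (by positivity) (by positivity), one_mul]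
  gcongr

/-- The normalized Bessel function `∑ (-q)^j m! / ((m+j)! j!) = m! q^{-m/2} J_m(2 √q)`. -/
def besselFactor (m : ℕ) (q : ℂ) : ℂ := ∑' j, besselCoeff m j * q ^ j

lemma hasSum_besselFactor (m : ℕ) (q : ℂ) :
    HasSum (fun j => besselCoeff m j * q ^ j) (besselFactor m q) :=
  (summable_pow_mul_of_le_factorial (norm_besselCoeff_le m) q).hasSum

lemma norm_besselFactor_le (m : ℕ) (q : ℂ) : ‖besselFactor m q‖ ≤ Real.exp ‖q‖ := by
  have h := NormedSpace.expSeries_div_hasSum_exp (𝔸 := ℝ) ‖q‖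
  rw [← Real.exp_eq_exp_ℝ] at h
  refine tsum_of_norm_bounded h fun j => ?_
  rw [norm_mul, norm_pow]
  calc _ ≤ 1 / j.factorial * ‖q‖ ^ j := by gcongr; exact norm_besselCoeff_le m j
    _ = _ := by ring

lemma differentiable_besselFactor (m : ℕ) : Differentiable ℂ (besselFactor m) := fun q =>
  (hasDerivAt_tsum_pow (norm_besselCoeff_le m) q).differentiableAt

lemma integral_pow_mul_one_sub_pow (m j : ℕ) :
    ∫ t in (0 : ℝ)..1, (t : ℂ) ^ m * (1 - t) ^ j =
      (m.factorial * j.factorial : ℂ) / (m + j + 1).factorial := by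
  have h := Complex.Gamma_mul_Gamma_eq_betaIntegral (s := m + 1) (t := j + 1)
    (by simp; positivity) (by simp; positivity)
  rw [Complex.Gamma_nat_eq_factorial, Complex.Gamma_nat_eq_factorial,
    show (m + 1 + (j + 1) : ℂ) = ((m + j + 1 : ℕ) : ℂ) + 1 by push_cast; ring,
    Complex.Gamma_nat_eq_factorial, Complex.betaIntegral] at h
  simp only [add_sub_cancel_right, Complex.cpow_natCast] at h
  rw [h, mul_div_cancel_left₀]
  exact_mod_cast (Nat.factorial_pos _).ne'

/-- `∫₀¹ t^m h_i(q(1-t)) dt`, expanded in powers of `q`. -/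
lemma hasSum_integral_besselFactor (i m : ℕ) (q : ℂ) :
    HasSum (fun j => besselCoeff i j * q ^ j * ((m.factorial * j.factorial : ℂ) /
      (m + j + 1).factorial)) (∫ t in (0 : ℝ)..1, (t : ℂ) ^ m * besselFactor i (q * (1 - t))) := by
  have hs : Summable fun j : ℕ => ‖q‖ ^ j / j.factorial := Real.summable_pow_div_factorial ‖q‖
  have h := hasSum_intervalIntegral_of_norm_le
    (F := fun j t => (t : ℂ) ^ m * (besselCoeff i j * (q * (1 - t)) ^ j))
    (f := fun t => (t : ℂ) ^ m * besselFactor i (q * (1 - t))) zero_le_one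
    (fun j => by fun_prop) hs (fun j t ht => ?_)
    (fun t _ => (hasSum_besselFactor i _).mul_left _)
  · refine (congrArg (fun f : ℕ → ℂ => HasSum f _) (funext fun j => ?_)).mp h
    rw [← integral_pow_mul_one_sub_pow, ← intervalIntegral.integral_const_mul]
    refine intervalIntegral.integral_congr fun t _ => ?_
    simp only [mul_pow]
    ring
  · have h1 : ‖(t : ℂ)‖ ≤ 1 := by
      rw [Complex.norm_real, Real.norm_of_nonneg ht.1]; exact ht.2
    have h2 : ‖1 - (t : ℂ)‖ ≤ 1 := by
      rw [← Complex.ofReal_one, ← Complex.ofReal_sub, Complex.norm_real,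
        Real.norm_of_nonneg (by linarith [ht.2])]
      linarith [ht.1]
    rw [norm_mul, norm_mul, norm_pow, norm_pow, norm_mul]
    calc _ ≤ 1 ^ m * (1 / j.factorial * (‖q‖ * 1) ^ j) := by
          gcongr; exact norm_besselCoeff_le i j
      _ = _ := by rw [one_pow, mul_one]; ring

/-- By the beta integral, the coefficient of q^{j+1} on the left is minus the integrated coefficient
of q^j of `besselFactor 1`. Since m enters the integrand only through t^m, a sum against a_m W^m
becomes the plain polynomial at tW. -/
lemma besselFactor_eq_integral (m : ℕ) (q : ℂ) :
    besselFactor m q = 1 - q * ∫ t in (0 : ℝ)..1, (t : ℂ) ^ m * besselFactor 1 (q * (1 - t)) := by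
  rw [← (hasSum_integral_besselFactor 1 m q).tsum_eq, besselFactor,
    (hasSum_besselFactor m q).summable.tsum_eq_zero_add, ← tsum_mul_left, sub_eq_add_neg,
    ← tsum_neg]
  congr 1
  · have : (m.factorial : ℂ) ≠ 0 := by exact_mod_cast m.factorial_ne_zero
    simp [besselCoeff, this]
  · refine tsum_congr fun j => ?_
    have h1 : (j.factorial : ℂ) ≠ 0 := by exact_mod_cast j.factorial_ne_zero
    rw [besselCoeff, besselCoeff, add_comm 1 j, ← add_assoc, Nat.factorial_one, Nat.cast_one]
    field_simp
    ring

/-- The same beta integral; the factor j + 1 from differentiation replaces `besselFactor 1` by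
`besselFactor 0`. -/
lemma hasDerivAt_besselFactor (m : ℕ) (q : ℂ) :
    HasDerivAt (besselFactor m)
      (-∫ t in (0 : ℝ)..1, (t : ℂ) ^ m * besselFactor 0 (q * (1 - t))) q := by
  refine (hasDerivAt_tsum_pow (norm_besselCoeff_le m) q).congr_deriv ?_
  rw [← (hasSum_integral_besselFactor 0 m q).tsum_eq, ← tsum_neg]
  refine tsum_congr fun j => ?_
  have h1 : (j.factorial : ℂ) ≠ 0 := by exact_mod_cast j.factorial_ne_zero
  have h2 : (j : ℂ) + 1 ≠ 0 := by exact_mod_cast j.succ_ne_zero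
  rw [besselCoeff, besselCoeff, zero_add, ← add_assoc, Nat.factorial_zero, Nat.cast_one,
    Nat.factorial_succ j]
  push_cast
  field_simp
  ring

lemma sum_mul_integral_besselFactor (i : ℕ) (S : Finset ℕ) (a : ℕ → ℂ) (W q : ℂ) :
    ∑ m ∈ S, a m * W ^ m * ∫ t in (0 : ℝ)..1, (t : ℂ) ^ m * besselFactor i (q * (1 - t)) =
      ∫ t in (0 : ℝ)..1, (∑ m ∈ S, a m * (t * W) ^ m) * besselFactor i (q * (1 - t)) := by
  have hc := (differentiable_besselFactor i).continuous
  simp_rw [sum_mul]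
  rw [intervalIntegral.integral_finsetSum
    (fun m _ => Continuous.intervalIntegrable (by fun_prop) _ _)]
  refine sum_congr rfl fun m _ => ?_
  rw [← intervalIntegral.integral_const_mul]
  refine intervalIntegral.integral_congr fun t _ => ?_
  simp only [mul_pow]
  ring

lemma sum_mul_besselFactor (S : Finset ℕ) (a : ℕ → ℂ) (W q : ℂ) :
    ∑ m ∈ S, a m * W ^ m * besselFactor m q = ∑ m ∈ S, a m * W ^ m -
      q * ∫ t in (0 : ℝ)..1, (∑ m ∈ S, a m * (t * W) ^ m) * besselFactor 1 (q * (1 - t)) := by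
  rw [← sum_mul_integral_besselFactor, mul_sum, ← sum_sub_distrib]
  refine sum_congr rfl fun m _ => ?_
  rw [besselFactor_eq_integral m q]
  ring

lemma norm_integral_mul_besselFactor_le (i : ℕ) {q : ℂ} {f : ℝ → ℂ} (hf : Continuous f) :
    ‖∫ t in (0 : ℝ)..1, f t * besselFactor i (q * (1 - t))‖ ≤
      Real.exp ‖q‖ * ∫ t in (0 : ℝ)..1, ‖f t‖ := by
  rw [← intervalIntegral.integral_const_mul]
  refine intervalIntegral.norm_integral_le_of_norm_le zero_le_one
    (Eventually.of_forall fun t ht => ?_) (Continuous.intervalIntegrable (by fun_prop) _ _)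
  have h2 : ‖1 - (t : ℂ)‖ ≤ 1 := by
    rw [← Complex.ofReal_one, ← Complex.ofReal_sub, Complex.norm_real,
      Real.norm_of_nonneg (by linarith [ht.2])]
    linarith [ht.1]
  rw [norm_mul, mul_comm]
  gcongr
  refine (norm_besselFactor_le i _).trans ?_
  rw [norm_mul]
  gcongr
  nlinarith [norm_nonneg q]

/-- The Bessel factors cost only the values of the plain polynomial on the segment [0, W], with a
constant independent of its degree. -/
lemma norm_sum_besselFactor_sub_le (S : Finset ℕ) (a : ℕ → ℂ) (W q : ℂ) :
    ‖∑ m ∈ S, a m * W ^ m * besselFactor m q - ∑ m ∈ S, a m * W ^ m‖ ≤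
      ‖q‖ * Real.exp ‖q‖ * ∫ t in (0 : ℝ)..1, ‖∑ m ∈ S, a m * (t * W) ^ m‖ := by
  rw [sum_mul_besselFactor, sub_sub_cancel_left, norm_neg, norm_mul, mul_assoc]
  gcongr
  exact norm_integral_mul_besselFactor_le 1 (by fun_prop)

/-! ### The Herglotz function as a Fourier–Bessel sum -/

/-- Expansion of the exponential inside an integral against unimodular factors. -/
lemma hasSum_integral_exp_mul (c : ℂ) {u v : ℝ → ℂ} (hu : Continuous u) (hv : Continuous v)
    {K : ℝ} (hu1 : ∀ t, ‖u t‖ = 1) (hv1 : ∀ t, ‖v t‖ ≤ K) {b : ℝ} (hb : 0 ≤ b) :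
    HasSum (fun j : ℕ => c ^ j / j.factorial * ∫ t in (0 : ℝ)..b, u t ^ j * v t)
      (∫ t in (0 : ℝ)..b, Complex.exp (c * u t) * v t) := by
  have hs : Summable fun j : ℕ => ‖c‖ ^ j / j.factorial * K :=
    (Real.summable_pow_div_factorial ‖c‖).mul_right K
  have h := hasSum_intervalIntegral_of_norm_le (a := 0) (b := b)
    (F := fun j t => (c * u t) ^ j / j.factorial * v t)
    (f := fun t => Complex.exp (c * u t) * v t) hb (fun j => by fun_prop) hs
    (fun j t _ => by
      rw [norm_mul, norm_div, norm_pow, norm_mul, hu1, mul_one, Complex.norm_natCast]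
      gcongr
      exact hv1 t)
    (fun t _ => by
      have := NormedSpace.expSeries_div_hasSum_exp (𝔸 := ℂ) (c * u t)
      rw [← Complex.exp_eq_exp_ℂ] at this
      exact this.mul_right _)
  refine (congrArg (fun f : ℕ → ℂ => HasSum f _) (funext fun j => ?_)).mp h
  rw [← intervalIntegral.integral_const_mul]
  refine intervalIntegral.integral_congr fun t _ => ?_
  simp only [mul_pow]
  ring

lemma integral_exp_int_mul_I (l : ℤ) :
    ∫ t in (0 : ℝ)..(2 * π), Complex.exp (l * (t * Complex.I)) = if l = 0 then 2 * π else 0 := by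
  split_ifs with h
  · simp [h]
  · have hc : (l : ℂ) * Complex.I ≠ 0 := mul_ne_zero (by exact_mod_cast h) Complex.I_ne_zero
    have := integral_exp_mul_complex (a := 0) (b := 2 * π) hc
    have e : ∀ t : ℝ, (l : ℂ) * (t * Complex.I) = l * Complex.I * t := fun t => by ring
    simp_rw [e]
    rw [this]
    have h1 : Complex.exp (l * Complex.I * ((2 * π : ℝ) : ℂ)) = 1 :=
      Complex.exp_eq_one_iff.mpr ⟨l, by push_cast; ring⟩
    rw [h1]
    simp

/-- In the expansion of the exponential only the power j = l survives, by orthogonality. -/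
lemma integral_exp_conj_mul_pow (A : ℂ) (l : ℕ) :
    ∫ t in (0 : ℝ)..(2 * π), Complex.exp (A * Complex.exp (-(t * Complex.I))) *
      Complex.exp (t * Complex.I) ^ l = 2 * π * A ^ l / l.factorial := by
  have h := hasSum_integral_exp_mul A (u := fun t => Complex.exp (-(t * Complex.I)))
    (v := fun t => Complex.exp (t * Complex.I) ^ l) (K := 1) (b := 2 * π) (by fun_prop)
    (by fun_prop)
    (fun t => by rw [← neg_mul, ← Complex.ofReal_neg, Complex.norm_exp_ofReal_mul_I])
    (fun t => by rw [norm_pow, Complex.norm_exp_ofReal_mul_I, one_pow]) (by positivity)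
  have e : ∀ j : ℕ, ∫ t in (0 : ℝ)..(2 * π), Complex.exp (-(t * Complex.I)) ^ j *
      Complex.exp (t * Complex.I) ^ l = if j = l then 2 * π else 0 := fun j => by
    have := integral_exp_int_mul_I (l - j)
    have h2 : ((l : ℤ) - j = 0) ↔ j = l := by omega
    simp only [h2] at this
    rw [← this]
    refine intervalIntegral.integral_congr fun t _ => ?_
    rw [← Complex.exp_nat_mul, ← Complex.exp_nat_mul, ← Complex.exp_add]
    congr 1
    push_cast
    ring
  simp_rw [e] at h
  rw [← h.tsum_eq, tsum_eq_single l (fun j hj => by simp [hj])]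
  simp
  ring

/-- The Jacobi–Anger type formula for `∫ e^{ik z·φ} φ^m dσ`. -/
lemma integral_planeWave_mul_pow (k : ℝ) (z : ℂ) (m : ℕ) :
    ∫ t in (0 : ℝ)..(2 * π), Complex.exp (Complex.I * k *
        (inner ℝ z (Complex.exp (t * Complex.I)) : ℝ)) * Complex.exp (t * Complex.I) ^ m =
      2 * π * ((Complex.I * k * z / 2) ^ m / m.factorial *
        besselFactor m ((k ^ 2 * ‖z‖ ^ 2 / 4 : ℝ) : ℂ)) := by
  -- For φ = e^{it} the phase ik z·φ equals Aφ⁻¹ + Bφ. The two exponentials are expanded one after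
  -- the other, and AB = -k²|z|²/4 is minus the Bessel argument.
  set A : ℂ := Complex.I * k * z / 2
  set B : ℂ := Complex.I * k * conj z / 2
  have hAB : A * B = -((k ^ 2 * ‖z‖ ^ 2 / 4 : ℝ) : ℂ) := by
    have h1 : z * conj z = (‖z‖ : ℂ) ^ 2 := Complex.mul_conj' z
    simp only [A, B]
    push_cast
    rw [← h1]
    linear_combination (k ^ 2 * (z * conj z) / 4 : ℂ) * Complex.I_sq
  have hexp : ∀ t : ℝ, Complex.exp (Complex.I * k *
      (inner ℝ z (Complex.exp (t * Complex.I)) : ℝ)) =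
      Complex.exp (B * Complex.exp (t * Complex.I)) *
        Complex.exp (A * Complex.exp (-(t * Complex.I))) := fun t => by
    rw [← Complex.exp_add]
    congr 1
    have h1 : conj (Complex.exp (t * Complex.I)) = Complex.exp (-(t * Complex.I)) := by
      rw [← Complex.exp_conj]; simp
    have h2 : ((inner ℝ z (Complex.exp (t * Complex.I)) : ℝ) : ℂ) =
        (conj z * Complex.exp (t * Complex.I) + z * Complex.exp (-(t * Complex.I))) / 2 := by
      rw [Complex.inner, Complex.re_eq_add_conj, map_mul, Complex.conj_conj, h1]
      ring
    rw [h2]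
    simp only [A, B]
    ring
  have h := hasSum_integral_exp_mul B (u := fun t => Complex.exp (t * Complex.I))
    (v := fun t => Complex.exp (A * Complex.exp (-(t * Complex.I))) *
      Complex.exp (t * Complex.I) ^ m) (K := Real.exp ‖A‖) (b := 2 * π) (by fun_prop)
    (by fun_prop) (fun t => by rw [Complex.norm_exp_ofReal_mul_I])
    (fun t => by
      rw [norm_mul, norm_pow, Complex.norm_exp_ofReal_mul_I, one_pow, mul_one]
      refine (Complex.norm_exp_le_exp_norm _).trans ?_
      rw [norm_mul, ← neg_mul, ← Complex.ofReal_neg, Complex.norm_exp_ofReal_mul_I, mul_one])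
    (by positivity)
  have e1 : ∀ j : ℕ, ∫ t in (0 : ℝ)..(2 * π), Complex.exp (t * Complex.I) ^ j *
      (Complex.exp (A * Complex.exp (-(t * Complex.I))) * Complex.exp (t * Complex.I) ^ m) =
      2 * π * A ^ (m + j) / (m + j).factorial := fun j => by
    rw [← integral_exp_conj_mul_pow]
    refine intervalIntegral.integral_congr fun t _ => ?_
    simp only [pow_add]
    ring
  simp_rw [e1] at h
  have e2 : ∫ t in (0 : ℝ)..(2 * π), Complex.exp (Complex.I * k *
        (inner ℝ z (Complex.exp (t * Complex.I)) : ℝ)) * Complex.exp (t * Complex.I) ^ m =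
      ∫ t in (0 : ℝ)..(2 * π), Complex.exp (B * Complex.exp (t * Complex.I)) *
        (Complex.exp (A * Complex.exp (-(t * Complex.I))) * Complex.exp (t * Complex.I) ^ m) :=
    intervalIntegral.integral_congr fun t _ => by simp only [hexp]; ring
  rw [e2]
  refine h.unique ((congrArg (fun f : ℕ → ℂ => HasSum f _) (funext fun j => ?_)).mp
    (((hasSum_besselFactor m _).mul_left (A ^ m / m.factorial)).mul_left (2 * π : ℂ)))
  have h1 : (m.factorial : ℂ) ≠ 0 := by exact_mod_cast m.factorial_ne_zero
  have h3 : ((k ^ 2 * ‖z‖ ^ 2 / 4 : ℝ) : ℂ) = -(A * B) := by rw [hAB, neg_neg]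
  rw [h3, besselCoeff, neg_pow (A * B), mul_pow, pow_add]
  have h4 : ((-1 : ℂ) ^ j) * (-1) ^ j = 1 := by rw [← mul_pow]; simp
  have h5 : (m.factorial : ℂ) / m.factorial = 1 := div_self h1
  linear_combination (B ^ j / j.factorial * (2 * π * (A ^ m * A ^ j) / (m + j).factorial)) *
    (h4 + ((-1 : ℂ) ^ j) * (-1) ^ j * h5)

/-- The coefficient `1 / Γ(m/n + 1)`. -/
def mlCoeff (n m : ℕ) : ℂ := ((Real.Gamma ((m : ℝ) / n + 1))⁻¹ : ℝ)

/-- The Herglotz wave function of the density as a Fourier–Bessel sum. -/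
lemma herglotz_density {k : ℝ} (hk : 0 < k) (n N : ℕ) (y : ℂ) (ω : Circle) (s : ℝ) (x : ℂ) :
    herglotz k (density n N y ω s k) x =
      ∑ m ∈ range (n * N + 1), mlCoeff n m * (s * conj (ω : ℂ) / 2 * (x - y)) ^ m *
        besselFactor m ((k ^ 2 * ‖x - y‖ ^ 2 / 4 : ℝ) : ℂ) := by
  set c : ℕ → ℂ := fun m => ((Real.Gamma ((m : ℝ) + 1) / Real.Gamma ((m : ℝ) / n + 1) : ℝ) : ℂ)
  have hk' : (k : ℂ) ≠ 0 := by exact_mod_cast hk.ne'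
  have e : ∀ t : ℝ, Complex.exp (Complex.I * k * (inner ℝ x (Circle.exp t : ℂ) : ℝ)) *
      density n N y ω s k (Circle.exp t) = ∑ m ∈ range (n * N + 1),
        (c m * (s * conj (ω : ℂ) / (Complex.I * k)) ^ m / (2 * π)) *
        (Complex.exp (Complex.I * k * (inner ℝ (x - y) (Complex.exp (t * Complex.I)) : ℝ)) *
          Complex.exp (t * Complex.I) ^ m) := fun t => by
    rw [density, inner_sub_left, Complex.ofReal_sub, mul_sub, sub_eq_add_neg, Complex.exp_add,
      Circle.coe_exp, mul_sum, mul_sum]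
    refine sum_congr rfl fun m _ => ?_
    simp only [c]
    rw [show (s : ℂ) * conj (ω : ℂ) * Complex.exp (t * Complex.I) / (Complex.I * k) =
      s * conj (ω : ℂ) / (Complex.I * k) * Complex.exp (t * Complex.I) by ring, mul_pow]
    ring
  rw [herglotz]
  simp_rw [e]
  rw [intervalIntegral.integral_finsetSum
    (fun m _ => Continuous.intervalIntegrable (by
      have : Continuous fun t : ℝ => (inner ℝ (x - y) (Complex.exp (t * Complex.I)) : ℝ) :=
        continuous_const.inner (by fun_prop)
      fun_prop) _ _)]
  refine sum_congr rfl fun m _ => ?_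
  rw [intervalIntegral.integral_const_mul, integral_planeWave_mul_pow]
  simp only [c, mlCoeff, Real.Gamma_nat_eq_factorial]
  have h1 : (m.factorial : ℂ) ≠ 0 := by exact_mod_cast m.factorial_ne_zero
  have hpi : (π : ℂ) ≠ 0 := by exact_mod_cast Real.pi_ne_zero
  -- The density is built so that Γ(m+1) cancels the 1/m! of the plane-wave formula and (ik)^{-m}
  -- cancels its (ik)^m.
  have h2 : (s * conj (ω : ℂ) / 2 * (x - y)) ^ m = (s * conj (ω : ℂ) / (Complex.I * k)) ^ m *
      (Complex.I * k * (x - y) / 2) ^ m := by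
    rw [← mul_pow]
    congr 1
    field_simp [Complex.I_ne_zero]
  rw [h2]
  push_cast
  field_simp

/-! ### Bounds for the Sobolev norm -/

/-- The classical gradient of a `C¹` function is a weak gradient. -/
lemma isWeakGradient_fderiv {U : Set ℂ} {v : ℂ → ℂ} (hv : ContDiff ℝ 1 v) :
    IsWeakGradient U v (fun j x => fderiv ℝ v x (![1, Complex.I] j)) := by
  have hc : ∀ e : ℂ, Continuous fun x => fderiv ℝ v x e := fun e =>
    (hv.continuous_fderiv one_ne_zero).clm_apply continuous_const
  refine ⟨hv.continuous.locallyIntegrable.locallyIntegrableOn _, fun j =>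
    ⟨(hc _).locallyIntegrable.locallyIntegrableOn _, fun φ hφ hφc hφU => ?_⟩⟩
  have hφ1 : Continuous fun x => fderiv ℝ φ x (![1, Complex.I] j) :=
    (hφ.continuous_fderiv (by simp)).clm_apply continuous_const
  have hφ2 : HasCompactSupport fun x => fderiv ℝ φ x (![1, Complex.I] j) :=
    hφc.fderiv_apply (𝕜 := ℝ) _
  have hz : ∀ x, x ∉ U → φ x = 0 := fun x hx => image_eq_zero_of_notMem_tsupport fun h => hx (hφU h)
  have hz' : ∀ x, x ∉ U → fderiv ℝ φ x = 0 := fun x hx =>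
    fderiv_of_notMem_tsupport (𝕜 := ℝ) fun h => hx (hφU h)
  rw [MeasureTheory.setIntegral_eq_integral_of_forall_compl_eq_zero
      (fun x hx => by rw [hz' x hx]; simp),
    MeasureTheory.setIntegral_eq_integral_of_forall_compl_eq_zero
      (fun x hx => by rw [hz x hx, zero_smul]),
    integral_smul_fderiv_eq_neg_fderiv_smul_of_integrable, neg_neg]
  · exact (hφ1.smul hv.continuous).integrable_of_hasCompactSupport hφ2.smul_right
  · exact (hφ.continuous.smul (hc _)).integrable_of_hasCompactSupport hφc.smul_right
  · exact (hφ.continuous.smul hv.continuous).integrable_of_hasCompactSupport hφc.smul_right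
  · exact fun x _ => (hφ.differentiable (by simp)) x
  · exact fun x _ => (hv.differentiable one_ne_zero) x

/-- The classical gradient competes in the infimum; the 3 counts v and its two partial derivatives.
-/
lemma h1Norm_le {U : Set ℂ} (hU : IsOpen U) {v : ℂ → ℂ} (hv : ContDiff ℝ 1 v) {η : ℝ}
    (h0 : ∀ x ∈ U, ‖v x‖ ≤ η) (h1 : ∀ x ∈ U, ∀ e : ℂ, ‖e‖ = 1 → ‖fderiv ℝ v x e‖ ≤ η) :
    h1Norm U v ≤
      (3 * (MeasureTheory.volume U ^ (2 : ℝ)⁻¹ * ENNReal.ofReal η) ^ 2) ^ (1 / 2 : ℝ) := by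
  have key : ∀ f : ℂ → ℂ, (∀ x ∈ U, ‖f x‖ ≤ η) →
      MeasureTheory.eLpNorm f 2 (MeasureTheory.volume.restrict U) ≤
        MeasureTheory.volume U ^ (2 : ℝ)⁻¹ * ENNReal.ofReal η := fun f hf => by
    have := MeasureTheory.eLpNorm_le_of_ae_bound (p := 2) (μ := MeasureTheory.volume.restrict U)
      (f := f) (C := η) ((MeasureTheory.ae_restrict_iff' hU.measurableSet).mpr
        (Eventually.of_forall hf))
    simpa using this
  refine iInf₂_le_of_le _ (isWeakGradient_fderiv hv) ?_
  refine ENNReal.rpow_le_rpow ?_ (by norm_num)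
  rw [Fin.sum_univ_two]
  have e : ∀ a : ℝ≥0∞, 3 * a = a + (a + a) := fun a => by ring
  rw [e]
  gcongr
  · exact key _ h0
  · exact key _ fun x hx => h1 x hx _ (by simp)
  · exact key _ fun x hx => h1 x hx _ (by simp)

lemma tendsto_h1Norm_zero {U : Set ℂ} (hU : IsOpen U)
    (hfin : MeasureTheory.volume U ≠ ∞) {v : ℕ → ℂ → ℂ} (hv : ∀ N, ContDiff ℝ 1 (v N))
    {η : ℕ → ℝ} (hη : Tendsto η atTop (𝓝 0)) (h0 : ∀ᶠ N in atTop, ∀ x ∈ U, ‖v N x‖ ≤ η N)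
    (h1 : ∀ᶠ N in atTop, ∀ x ∈ U, ∀ e : ℂ, ‖e‖ = 1 → ‖fderiv ℝ (v N) x e‖ ≤ η N) :
    Tendsto (fun N => h1Norm U (v N)) atTop (𝓝 0) := by
  have hlim : Tendsto (fun N => (3 * (MeasureTheory.volume U ^ (2 : ℝ)⁻¹ *
      ENNReal.ofReal (η N)) ^ 2) ^ (1 / 2 : ℝ)) atTop (𝓝 0) := by
    have hA : MeasureTheory.volume U ^ (2 : ℝ)⁻¹ ≠ ∞ :=
      ENNReal.rpow_ne_top_of_nonneg (by norm_num) hfin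
    have h2 := ENNReal.Tendsto.const_mul (ENNReal.tendsto_ofReal hη) (Or.inr hA)
    rw [ENNReal.ofReal_zero, mul_zero] at h2
    have h3 := ENNReal.Tendsto.const_mul (ENNReal.Tendsto.pow (n := 2) h2)
      (Or.inr (by norm_num : (3 : ℝ≥0∞) ≠ ∞))
    have h4 := h3.ennrpow_const (1 / 2 : ℝ)
    simpa using h4
  refine tendsto_of_tendsto_of_tendsto_of_le_of_le' tendsto_const_nhds hlim
    (Eventually.of_forall fun _ => zero_le) ?_
  filter_upwards [h0, h1] with N hN0 hN1 using h1Norm_le hU (hv N) hN0 hN1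

/-! ### Gradients of Fourier–Bessel sums -/

/-- Fourier–Bessel sums `∑ a_m (c z)^m h_m(k²|z|²/4)`. -/
def besselSum (S : Finset ℕ) (a : ℕ → ℂ) (c : ℂ) (k : ℝ) (z : ℂ) : ℂ :=
  ∑ m ∈ S, a m * (c * z) ^ m * besselFactor m ((k ^ 2 * ‖z‖ ^ 2 / 4 : ℝ) : ℂ)

lemma contDiff_besselSum (S : Finset ℕ) (a : ℕ → ℂ) (c : ℂ) (k : ℝ) :
    ContDiff ℝ 1 (besselSum S a c k) := by
  refine ContDiff.sum fun m _ => ?_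
  have h1 : ContDiff ℝ 1 fun z : ℂ => ((k ^ 2 * ‖z‖ ^ 2 / 4 : ℝ) : ℂ) :=
    Complex.ofRealCLM.contDiff.comp
      ((contDiff_const.mul (contDiff_norm_sq ℝ)).div_const 4)
  have h2 : ContDiff ℝ 1 (besselFactor m) :=
    ((differentiable_besselFactor m).contDiff (n := 1)).restrict_scalars ℝ
  exact (contDiff_const.mul ((contDiff_const.mul contDiff_id).pow m)).mul (h2.comp h1)

/-- Product rule along z + td. The power (cz)^m gives the Euler derivative times d/z, whence z ≠ 0;
the Bessel factor gives the integral with `besselFactor 0`, since q has derivative (k²/2) z·d. -/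
lemma fderiv_besselSum (S : Finset ℕ) (a : ℕ → ℂ) (c : ℂ) (k : ℝ) {z : ℂ} (hz : z ≠ 0) (d : ℂ) :
    fderiv ℝ (besselSum S a c k) z d =
      d / z * ∑ m ∈ S, (m * a m) * (c * z) ^ m * besselFactor m ((k ^ 2 * ‖z‖ ^ 2 / 4 : ℝ) : ℂ) -
      ((k ^ 2 / 2 * inner ℝ z d : ℝ) : ℂ) * ∫ t in (0 : ℝ)..1, (∑ m ∈ S, a m * (t * (c * z)) ^ m) *
        besselFactor 0 (((k ^ 2 * ‖z‖ ^ 2 / 4 : ℝ) : ℂ) * (1 - t)) := by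
  have hline : HasDerivAt (fun t : ℝ => z + t * d) d 0 := by
    simpa using ((Complex.ofRealCLM.hasDerivAt (x := 0)).mul_const d).const_add z
  have h1 : HasDerivAt (fun t : ℝ => besselSum S a c k (z + t * d))
      (fderiv ℝ (besselSum S a c k) z d) 0 := by
    have h := ((contDiff_besselSum S a c k).differentiable one_ne_zero z).hasFDerivAt
    have e : z = z + ((0 : ℝ) : ℂ) * d := by simp
    rw [e] at h
    have := h.comp_hasDerivAt 0 hline
    rw [← e] at this
    exact this
  refine h1.unique ?_
  rw [← sum_mul_integral_besselFactor, mul_sum, mul_sum, ← sum_sub_distrib]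
  refine HasDerivAt.fun_sum fun m _ => ?_
  have hn : HasDerivAt (fun t : ℝ => ((k ^ 2 * ‖z + t * d‖ ^ 2 / 4 : ℝ) : ℂ))
      ((k ^ 2 / 2 * inner ℝ z d : ℝ) : ℂ) 0 := by
    have h2 := ((hline.norm_sq.const_mul (k ^ 2)).div_const 4).ofReal_comp
    refine h2.congr_deriv ?_
    simp only [Complex.ofReal_zero, zero_mul, add_zero]
    push_cast
    ring
  have hb : HasDerivAt (fun t : ℝ => besselFactor m ((k ^ 2 * ‖z + t * d‖ ^ 2 / 4 : ℝ) : ℂ))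
      ((-∫ t in (0 : ℝ)..1, (t : ℂ) ^ m *
        besselFactor 0 (((k ^ 2 * ‖z‖ ^ 2 / 4 : ℝ) : ℂ) * (1 - t))) *
        ((k ^ 2 / 2 * inner ℝ z d : ℝ) : ℂ)) 0 := by
    have h3 := hasDerivAt_besselFactor m ((k ^ 2 * ‖z‖ ^ 2 / 4 : ℝ) : ℂ)
    exact HasDerivAt.comp_of_eq (h := fun t : ℝ => ((k ^ 2 * ‖z + t * d‖ ^ 2 / 4 : ℝ) : ℂ))
      0 h3 hn (by simp)
  have hp : HasDerivAt (fun t : ℝ => a m * (c * (z + t * d)) ^ m)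
      (a m * (m * (c * z) ^ m * (d / z))) 0 := by
    have h4 := ((hline.const_mul c).fun_pow m).const_mul (a m)
    refine h4.congr_deriv ?_
    rcases m with _ | m
    · simp
    · simp only [Complex.ofReal_zero, zero_mul, add_zero, add_tsub_cancel_right, pow_succ]
      field_simp
  refine (hp.fun_mul hb).congr_deriv ?_
  simp only [Complex.ofReal_zero, zero_mul, add_zero]
  ring

/-! ### Decay along segments -/

/-- The decay rate `1/(1+a) + log(1+a)/a`. -/
def decayRate (a : ℝ) : ℝ := (1 + a)⁻¹ + Real.log (1 + a) / a

lemma tendsto_decayRate : Tendsto decayRate atTop (𝓝 0) := by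
  have h1 : Tendsto (fun a : ℝ => 1 + a) atTop atTop := tendsto_atTop_add_const_left _ _ tendsto_id
  have h2 : Tendsto (fun x : ℝ => Real.log x / x) atTop (𝓝 0) := by
    have := Real.isLittleO_log_id_atTop.tendsto_div_nhds_zero
    simpa using this
  have h3 : Tendsto (fun a : ℝ => Real.log (1 + a) / (1 + a) * (2 : ℝ)) atTop (𝓝 0) := by
    simpa using (h2.comp h1).mul_const 2
  have h4 : Tendsto (fun a : ℝ => Real.log (1 + a) / a) atTop (𝓝 0) := by
    refine tendsto_of_tendsto_of_tendsto_of_le_of_le' tendsto_const_nhds h3 ?_ ?_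
    · filter_upwards [eventually_ge_atTop 1] with a ha
      exact div_nonneg (Real.log_nonneg (by linarith)) (by linarith)
    · filter_upwards [eventually_ge_atTop 1] with a ha
      have hl : 0 ≤ Real.log (1 + a) := Real.log_nonneg (by linarith)
      rw [div_mul_eq_mul_div, div_le_div_iff₀ (by linarith) (by linarith)]
      nlinarith
  have h5 := (tendsto_inv_atTop_zero.comp h1).add h4
  rw [add_zero] at h5
  exact h5

lemma integral_inv_one_add_mul {a : ℝ} (ha : 0 < a) :
    ∫ t in (0 : ℝ)..1, (1 + t * a)⁻¹ = Real.log (1 + a) / a := by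
  have hd : ∀ t ∈ Set.uIcc (0 : ℝ) 1,
      HasDerivAt (fun t => Real.log (1 + t * a) / a) (1 + t * a)⁻¹ t := fun t ht => by
    rw [Set.uIcc_of_le zero_le_one] at ht
    have hpos : 1 + t * a ≠ 0 := by have := ht.1; positivity
    have := (((hasDerivAt_id t).mul_const a).const_add 1).log hpos |>.div_const a
    refine this.congr_deriv ?_
    simp only [id]
    field_simp
  rw [intervalIntegral.integral_eq_sub_of_hasDerivAt hd]
  · simp
  · refine ContinuousOn.intervalIntegrable fun t ht => ?_
    rw [Set.uIcc_of_le zero_le_one] at ht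
    have hpos : 1 + t * a ≠ 0 := by have := ht.1; positivity
    exact ContinuousAt.continuousWithinAt (by fun_prop (disch := exact hpos))

lemma integral_norm_le_of_decay {f : ℝ → ℂ} (hf : Continuous f) {a K ε : ℝ} (ha : 0 < a)
    (h : ∀ t ∈ Set.Icc (0 : ℝ) 1, ‖f t‖ ≤ K * (1 + t * a)⁻¹ + ε) :
    ∫ t in (0 : ℝ)..1, ‖f t‖ ≤ K * (Real.log (1 + a) / a) + ε := by
  have hi : IntervalIntegrable (fun t : ℝ => (1 + t * a)⁻¹) MeasureTheory.volume 0 1 := by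
    refine ContinuousOn.intervalIntegrable fun t ht => ?_
    rw [Set.uIcc_of_le zero_le_one] at ht
    have hpos : 1 + t * a ≠ 0 := by have := ht.1; positivity
    exact ContinuousAt.continuousWithinAt (by fun_prop (disch := exact hpos))
  have := intervalIntegral.integral_mono_on (μ := MeasureTheory.volume) zero_le_one
    (hf.norm.intervalIntegrable 0 1)
    ((hi.const_mul K).add (intervalIntegrable_const (c := ε))) h
  refine this.trans_eq ?_
  rw [intervalIntegral.integral_add (hi.const_mul K) intervalIntegrable_const,
    intervalIntegral.integral_const_mul, integral_inv_one_add_mul ha]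
  simp

/-- Decay along the segment `[0, W]` passes to the Fourier–Bessel sum. -/
lemma norm_sum_besselFactor_le_of_decay (S : Finset ℕ) (b : ℕ → ℂ) {W q : ℂ} {a K ε Q : ℝ}
    (ha : 0 < a) (hK : 0 ≤ K) (hq : ‖q‖ ≤ Q)
    (h : ∀ t ∈ Set.Icc (0 : ℝ) 1, ‖∑ m ∈ S, b m * (t * W) ^ m‖ ≤ K * (1 + t * a)⁻¹ + ε) :
    ‖∑ m ∈ S, b m * W ^ m * besselFactor m q‖ ≤
        (1 + Q * Real.exp Q) * (K * decayRate a + ε) ∧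
    ‖∫ t in (0 : ℝ)..1, (∑ m ∈ S, b m * (t * W) ^ m) * besselFactor 0 (q * (1 - t))‖ ≤
        Real.exp Q * (K * decayRate a + ε) := by
  have hQ : 0 ≤ Q := (norm_nonneg q).trans hq
  have hlog : 0 ≤ Real.log (1 + a) / a := div_nonneg (Real.log_nonneg (by linarith)) ha.le
  have hinv : 0 ≤ (1 + a)⁻¹ := by positivity
  have h1 := integral_norm_le_of_decay (f := fun t : ℝ => ∑ m ∈ S, b m * (t * W) ^ m)
    (by fun_prop) ha h
  have h2 : ‖∑ m ∈ S, b m * W ^ m‖ ≤ K * (1 + a)⁻¹ + ε := by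
    simpa using h 1 ⟨zero_le_one, le_rfl⟩
  have h3 : K * (Real.log (1 + a) / a) + ε ≤ K * decayRate a + ε := by
    rw [decayRate]; gcongr; linarith
  have h4 : K * (1 + a)⁻¹ + ε ≤ K * decayRate a + ε := by
    rw [decayRate]; gcongr; linarith
  have hI : 0 ≤ ∫ t in (0 : ℝ)..1, ‖∑ m ∈ S, b m * (t * W) ^ m‖ :=
    intervalIntegral.integral_nonneg zero_le_one fun _ _ => norm_nonneg _
  constructor
  · have h5 := norm_sum_besselFactor_sub_le S b W q
    have h6 : ‖q‖ * Real.exp ‖q‖ * ∫ t in (0 : ℝ)..1, ‖∑ m ∈ S, b m * (t * W) ^ m‖ ≤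
        Q * Real.exp Q * (K * decayRate a + ε) := by
      gcongr
      exact h1.trans h3
    have h7 := norm_sub_norm_le (∑ m ∈ S, b m * W ^ m * besselFactor m q) (∑ m ∈ S, b m * W ^ m)
    linarith
  · refine (norm_integral_mul_besselFactor_le 0 (by fun_prop)).trans ?_
    gcongr
    exact h1.trans h3

/-! ### Decay off the cone -/

/-- A compact set disjoint from a closed cone is separated from it by a larger cone. -/
lemma exists_cone_separation {D : Set ℂ} {R : ℝ} (hDR : closure D ⊆ Metric.ball 0 R) {y : ℂ}
    (hy : y ∈ Metric.ball (0 : ℂ) R) {ω : Circle} {a : ℝ} (ha : 0 < a) (ha' : a ≤ π / 2)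
    (hdisj : closure (cone y ω a) ∩ closure D = ∅) :
    ∃ c d R₁ : ℝ, c < Real.cos a ∧ 0 < d ∧ 0 ≤ R₁ ∧ R₁ < R ∧ ∀ x ∈ D, d ≤ ‖x - y‖ ∧
      ‖x - y‖ ≤ 2 * R₁ ∧ inner ℝ (x - y) (ω : ℂ) ≤ c * ‖x - y‖ := by
  have hpi := Real.pi_pos
  have hy' : ‖y‖ < R := by simpa using hy
  rcases D.eq_empty_or_nonempty with rfl | hD
  · exact ⟨Real.cos a - 1, 1, 0, by linarith, one_pos, le_rfl, (norm_nonneg y).trans_lt hy',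
      fun x hx => hx.elim⟩
  have hcomp : IsCompact (closure D) :=
    Metric.isCompact_of_isClosed_isBounded isClosed_closure (Metric.isBounded_ball.subset hDR)
  have hne : (closure D).Nonempty := hD.closure
  have hcos0 : 0 ≤ Real.cos a := Real.cos_nonneg_of_mem_Icc ⟨by linarith, ha'⟩
  have hcos1 : Real.cos a < 1 := by
    rw [← Real.cos_zero]
    exact Real.cos_lt_cos_of_nonneg_of_le_pi_div_two le_rfl ha' ha
  have hlt : ∀ x ∈ closure D, inner ℝ (x - y) (ω : ℂ) < ‖x - y‖ * Real.cos a := by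
    intro x hx
    by_contra! hge
    have hmem : x ∈ closure (cone y ω a) := by
      -- A step tω raises the inner product by t and the other side by at most t cos a < t. So every
      -- x satisfying the non-strict inequality, the vertex included, lies in the closure of the
      -- cone.
      have hlim : Tendsto (fun t : ℝ => x + t * (ω : ℂ)) (𝓝[>] 0) (𝓝 x) := by
        have : Continuous fun t : ℝ => x + t * (ω : ℂ) := by fun_prop
        simpa using this.continuousWithinAt (s := Set.Ioi 0) (x := 0) |>.tendsto
      refine mem_closure_of_tendsto hlim ?_
      filter_upwards [self_mem_nhdsWithin] with t ht
      have ht0 : 0 < t := ht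
      have e : x + t * (ω : ℂ) - y = (x - y) + (t : ℝ) • (ω : ℂ) := by
        rw [Complex.real_smul]; ring
      show ‖x + t * (ω : ℂ) - y‖ * Real.cos a < inner ℝ (x + t * (ω : ℂ) - y) (ω : ℂ)
      rw [e, inner_add_left, real_inner_smul_left, real_inner_self_eq_norm_sq, Circle.norm_coe]
      have h1 : ‖(x - y) + (t : ℝ) • (ω : ℂ)‖ ≤ ‖x - y‖ + t := by
        refine (norm_add_le _ _).trans ?_
        rw [norm_smul, Circle.norm_coe, Real.norm_of_nonneg ht0.le, mul_one]
      nlinarith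
    have : x ∈ closure (cone y ω a) ∩ closure D := ⟨hmem, hx⟩
    rw [hdisj] at this
    exact this
  have hpos : ∀ x ∈ closure D, 0 < ‖x - y‖ := by
    intro x hx
    refine norm_pos_iff.mpr fun h => ?_
    have := hlt x hx
    rw [h] at this
    simp at this
  obtain ⟨x₁, hx₁, hmax₁⟩ := hcomp.exists_isMaxOn hne
    (f := fun x => inner ℝ (x - y) (ω : ℂ) / ‖x - y‖)
    (ContinuousOn.div (by fun_prop) (by fun_prop) fun x hx => (hpos x hx).ne')
  obtain ⟨x₂, hx₂, hmin₂⟩ := hcomp.exists_isMinOn hne (f := fun x => ‖x - y‖) (by fun_prop)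
  obtain ⟨x₃, hx₃, hmax₃⟩ := hcomp.exists_isMaxOn hne (f := fun x => ‖x‖) (by fun_prop)
  have hx₃' : ‖x₃‖ < R := by simpa using hDR hx₃
  -- ‖x - y‖ ≤ ‖x₃‖ + ‖y‖ = 2R₁ with R₁ < R strictly; this room is used for the circle in Cauchy's
  -- estimate.
  refine ⟨inner ℝ (x₁ - y) (ω : ℂ) / ‖x₁ - y‖, ‖x₂ - y‖, (‖x₃‖ + ‖y‖) / 2, ?_, hpos x₂ hx₂,
    by positivity, by linarith, fun x hx => ?_⟩
  · rw [div_lt_iff₀ (hpos _ hx₁), mul_comm]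
    exact hlt _ hx₁
  · have hx' := subset_closure hx
    refine ⟨hmin₂ hx', ?_, ?_⟩
    · have h1 : ‖x‖ ≤ ‖x₃‖ := hmax₃ hx'
      have := norm_sub_le x y
      linarith
    · have h1 : inner ℝ (x - y) (ω : ℂ) / ‖x - y‖ ≤ inner ℝ (x₁ - y) (ω : ℂ) / ‖x₁ - y‖ :=
        hmax₁ hx'
      rwa [div_le_iff₀ (hpos _ hx')] at h1

lemma hasDerivAt_truncated (n N : ℕ) (w : ℂ) :
    HasDerivAt (truncated n N)
      (∑ m ∈ range (n * N + 1), mlCoeff n m * (m * w ^ (m - 1))) w :=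
  HasDerivAt.fun_sum fun m _ => (hasDerivAt_pow m w).const_mul _

/-- Cauchy's estimate for the Euler derivative `w p'(w)` of the truncated series. -/
lemma norm_euler_truncated_le (n N : ℕ) {w : ℂ} {δ C : ℝ} (hδ : 0 < δ) (hC0 : 0 ≤ C)
    (hC : ∀ w' : ℂ, ‖w' - w‖ = δ * ‖w‖ → ‖truncated n N w'‖ ≤ C) :
    ‖∑ m ∈ range (n * N + 1), (m * mlCoeff n m) * w ^ m‖ ≤ C / δ := by
  rcases eq_or_ne w 0 with rfl | hw
  · rw [sum_eq_zero]
    · rw [norm_zero]; positivity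
    · intro m _
      rcases m with _ | m <;> simp
  have hw0 : 0 < ‖w‖ := norm_pos_iff.mpr hw
  have hd : Differentiable ℂ (truncated n N) := fun z =>
    (hasDerivAt_truncated n N z).differentiableAt
  have h := Complex.norm_deriv_le_of_forall_mem_sphere_norm_le (c := w) (R := δ * ‖w‖) (C := C)
    (by positivity) hd.diffContOnCl (fun z hz => hC z (by simpa [dist_eq_norm] using hz))
  rw [(hasDerivAt_truncated n N w).deriv] at h
  have e : ∑ m ∈ range (n * N + 1), (m * mlCoeff n m) * w ^ m =
      w * ∑ m ∈ range (n * N + 1), mlCoeff n m * (m * w ^ (m - 1)) := by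
    rw [mul_sum]
    refine sum_congr rfl fun m _ => ?_
    rcases m with _ | m
    · simp
    · rw [add_tsub_cancel_right, pow_succ]; ring
  rw [e, norm_mul]
  calc _ ≤ ‖w‖ * (C / (δ * ‖w‖)) := by gcongr
    _ = _ := by field_simp

/-- Decay of the truncated series and of its Euler derivative outside the central sector. -/
lemma exists_truncated_decay {n : ℕ} (hn : 1 ≤ n) {γ₀ γ R R₁ c : ℝ}
    (hγ₀eq : Real.log γ₀ + γ₀ / Real.exp 1 = 0) (hγ : 0 < γ) (hγγ₀ : γ < γ₀)
    (hR₁ : 0 ≤ R₁) (hR : R₁ < R) (hc : c < Real.cos (π / (2 * n))) {s : ℕ → ℝ}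
    (hs : ∀ N, 1 ≤ N → 0 < s N)
    (hsN : (fun N : ℕ => (R * s N) ^ n - γ / Real.exp 1 * N) =O[atTop] (fun _ : ℕ => (1 : ℝ))) :
    ∃ (K : ℝ) (ε : ℕ → ℝ), 0 ≤ K ∧ Tendsto ε atTop (𝓝 0) ∧
      ∀ᶠ N in atTop, ∀ w : ℂ, w.re ≤ c * ‖w‖ → ‖w‖ ≤ R₁ * s N →
        ‖∑ m ∈ range (n * N + 1), mlCoeff n m * w ^ m‖ ≤ K * (1 + ‖w‖)⁻¹ + ε N ∧
        ‖∑ m ∈ range (n * N + 1), (m * mlCoeff n m) * w ^ m‖ ≤ K * (1 + ‖w‖)⁻¹ + ε N := by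
  obtain ⟨c₂, hc₁, hc₂⟩ := exists_between hc
  obtain ⟨K, hK0, hK⟩ := exists_bound_outside_sector hn hc₂
  obtain ⟨ε, hε, hε0, hε'⟩ := exists_truncation_error hn hγ₀eq hγ hγγ₀ hsN
  -- For w' on the circle of radius δ‖w‖ about w: the first bound gives ‖w'‖ ≥ ‖w‖/2, the second
  -- keeps w' in the region defined by c₂, the third keeps ‖w'‖ ≤ R s(N), where truncation is
  -- controlled.
  set δ := min (1 / 2) (min ((c₂ - c) / (1 + |c₂|)) ((R - R₁) / R))
  have hR0 : 0 < R := by linarith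
  have hδ : 0 < δ := lt_min (by norm_num) (lt_min (div_pos (by linarith) (by positivity))
    (div_pos (by linarith) hR0))
  have hδ1 : δ ≤ 1 / 2 := min_le_left _ _
  have hδ2 : δ * (1 + |c₂|) ≤ c₂ - c := by
    rw [← le_div_iff₀ (by positivity)]
    exact (min_le_right _ _).trans (min_le_left _ _)
  have hδ3 : δ * R ≤ R - R₁ := by
    rw [← le_div_iff₀ hR0]
    exact (min_le_right _ _).trans (min_le_right _ _)
  refine ⟨2 * K / δ, fun N => ε N / δ, by positivity, by simpa using hε.div_const δ, ?_⟩
  filter_upwards [hε', eventually_ge_atTop 1] with N hN hN1 w hw1 hw2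
  have hs0 := hs N hN1
  have base : ∀ w : ℂ, w.re ≤ c₂ * ‖w‖ → ‖w‖ ≤ R * s N →
      ‖truncated n N w‖ ≤ K * (1 + ‖w‖)⁻¹ + ε N := fun w h1 h2 => by
    have h3 := hN w (by gcongr)
    have h4 : ‖mittagLeffler n w‖ ≤ K * (1 + ‖w‖)⁻¹ := by
      rw [← div_eq_mul_inv, le_div_iff₀ (by positivity), mul_comm]
      exact hK w h1
    have := norm_sub_norm_le (truncated n N w) (mittagLeffler n w)
    linarith
  have hinv : 0 ≤ (1 + ‖w‖)⁻¹ := by positivity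
  have hge : ∀ x : ℝ, 0 ≤ x → x ≤ x / δ := fun x hx => by
    rw [le_div_iff₀ hδ]; nlinarith
  constructor
  · refine (base w ?_ ?_).trans ?_
    · exact hw1.trans (by gcongr)
    · exact hw2.trans (by gcongr)
    · have h1 := hge (ε N) (hε0 N)
      have h2 := hge K hK0
      have h3 : K ≤ 2 * K / δ := by
        refine h2.trans ?_
        gcongr
        linarith
      gcongr
  · have := norm_euler_truncated_le n N (w := w) (C := 2 * K * (1 + ‖w‖)⁻¹ + ε N) hδ
      (by have := hε0 N; positivity) (fun w' hw' => ?_)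
    · refine this.trans_eq ?_
      ring
    · have h1 : ‖w'‖ ≤ ‖w‖ + δ * ‖w‖ := by
        have := norm_sub_norm_le w' w
        linarith
      have h2 : ‖w‖ - δ * ‖w‖ ≤ ‖w'‖ := by
        have := norm_sub_norm_le w w'
        rw [norm_sub_rev, hw'] at this
        linarith
      have h3 : w'.re ≤ w.re + δ * ‖w‖ := by
        have := Complex.re_le_norm (w' - w)
        rw [hw', Complex.sub_re] at this
        linarith
      have hw0 := norm_nonneg w
      have h4 : w'.re ≤ c₂ * ‖w'‖ := by
        have h5 : c₂ * ‖w‖ - |c₂| * (δ * ‖w‖) ≤ c₂ * ‖w'‖ := by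
          have h6 : |c₂ * (‖w‖ - ‖w'‖)| ≤ |c₂| * (δ * ‖w‖) := by
            rw [abs_mul]
            gcongr
            exact abs_le.mpr ⟨by linarith, by linarith⟩
          have := (abs_le.mp h6).2
          linarith
        nlinarith
      refine (base w' h4 ?_).trans ?_
      · have : δ * ‖w‖ ≤ δ * (R * s N) := by gcongr; exact hw2.trans (by gcongr)
        nlinarith
      · have h5 : (1 + ‖w‖) / 2 ≤ 1 + ‖w'‖ := by nlinarith
        have h6 : (1 + ‖w'‖)⁻¹ ≤ 2 * (1 + ‖w‖)⁻¹ := by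
          rw [← div_eq_mul_inv, inv_eq_one_div, div_le_div_iff₀ (by positivity) (by positivity)]
          linarith
        nlinarith

lemma tendsto_scale_atTop {n : ℕ} {R γ : ℝ} (hR : 0 < R) (hγ : 0 < γ) {s : ℕ → ℝ}
    (hsN : (fun N : ℕ => (R * s N) ^ n - γ / Real.exp 1 * N) =O[atTop] (fun _ : ℕ => (1 : ℝ)))
    (hs : ∀ N, 1 ≤ N → 0 < s N) : Tendsto s atTop atTop := by
  obtain ⟨C, hC⟩ := hsN.bound
  have h1 : Tendsto (fun N : ℕ => γ / Real.exp 1 * N - C) atTop atTop :=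
    tendsto_atTop_add_const_right _ _
      (tendsto_natCast_atTop_atTop.const_mul_atTop (by positivity))
  have h2 : Tendsto (fun N => (R * s N) ^ n) atTop atTop := by
    refine tendsto_atTop_mono' _ ?_ h1
    filter_upwards [hC] with N hN
    simp only [Real.norm_eq_abs, abs_one, mul_one] at hN
    linarith [(abs_le.mp hN).1]
  refine tendsto_atTop.mpr fun b => ?_
  filter_upwards [h2.eventually_gt_atTop ((R * max b 0) ^ n), eventually_ge_atTop 1] with N hN hN1
  have h3 := lt_of_pow_lt_pow_left₀ n (by have := hs N hN1; positivity) hN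
  have h4 := lt_of_mul_lt_mul_left h3 hR.le
  exact (le_max_left _ _).trans h4.le

lemma re_conj_mul (ω : Circle) (z : ℂ) : (conj (ω : ℂ) * z).re = inner ℝ z (ω : ℂ) := by
  rw [Complex.inner]
  simp [Complex.mul_re]

lemma norm_scale_mul {s : ℝ} (hs : 0 ≤ s) (ω : Circle) (z : ℂ) :
    ‖(s : ℂ) * conj (ω : ℂ) / 2 * z‖ = s / 2 * ‖z‖ := by
  rw [norm_mul, norm_div, norm_mul, Complex.norm_real, Real.norm_of_nonneg hs, RCLike.norm_conj,
    Circle.norm_coe]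
  simp

/-- The Herglotz functions vanish in the limit on sets whose closure misses the closed cone. -/
theorem tendsto_h1Norm_herglotz
    {k R γ₀ γ : ℝ} (hk : 0 < k) {D : Set ℂ} (hDopen : IsOpen D)
    (hDR : closure D ⊆ Metric.ball 0 R)
    (hγ₀eq : Real.log γ₀ + γ₀ / Real.exp 1 = 0) (hγ : 0 < γ) (hγγ₀ : γ < γ₀)
    {n : ℕ} (hn : 1 ≤ n) {s : ℕ → ℝ} (hs : ∀ N, 1 ≤ N → 0 < s N)
    (hsN : (fun N : ℕ => (R * s N) ^ n - γ / Real.exp 1 * N) =O[atTop] (fun _ : ℕ => (1 : ℝ)))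
    {y : ℂ} (hy : y ∈ Metric.ball (0 : ℂ) R) (ω : Circle)
    (hdisj : closure (cone y ω (π / (2 * n))) ∩ closure D = ∅) :
    Tendsto (fun N : ℕ => h1Norm D (herglotz k (density n N y ω (s N) k))) atTop (𝓝 0) := by
  have hpi := Real.pi_pos
  have hn1 : (1 : ℝ) ≤ n := by exact_mod_cast hn
  have hR0 : 0 < R := (norm_nonneg y).trans_lt (by simpa using hy)
  obtain ⟨c, d, R₁, hc, hd, hR₁, hR₁R, hsep⟩ := exists_cone_separation hDR hy (a := π / (2 * n))
    (by positivity) (by gcongr; linarith) hdisj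
  obtain ⟨K, ε, hK, hε, hdec⟩ :=
    exists_truncated_decay hn hγ₀eq hγ hγγ₀ hR₁ hR₁R hc hs hsN
  have hscale := tendsto_scale_atTop hR0 hγ hsN hs
  set v : ℕ → ℂ → ℂ := fun N x =>
    besselSum (range (n * N + 1)) (mlCoeff n) (s N * conj (ω : ℂ) / 2) k (x - y)
  have hv : ∀ N, herglotz k (density n N y ω (s N) k) = v N := fun N =>
    funext fun x => herglotz_density hk n N y ω (s N) x
  simp_rw [hv]
  set Q := k ^ 2 * R ^ 2
  have hQ : 0 ≤ Q := by positivity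
  set η₀ : ℕ → ℝ := fun N => K * decayRate (s N / 2 * d) + ε N
  have hη₀ : Tendsto η₀ atTop (𝓝 0) := by
    have h1 : Tendsto (fun N => s N / 2 * d) atTop atTop :=
      (hscale.atTop_div_const two_pos).atTop_mul_const hd
    simpa using ((tendsto_decayRate.comp h1).const_mul K).add hε
  set C₁ := 1 + Q * Real.exp Q
  set C₂ := d⁻¹ * C₁ + k ^ 2 / 2 * (2 * R) * Real.exp Q
  have hC₁ : 0 ≤ C₁ := by positivity
  have hC₂ : 0 ≤ C₂ := by positivity
  have key : ∀ᶠ N in atTop, ∀ x ∈ D, ‖v N x‖ ≤ C₁ * η₀ N ∧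
      ∀ e : ℂ, ‖e‖ = 1 → ‖fderiv ℝ (v N) x e‖ ≤ C₂ * η₀ N := by
    filter_upwards [hdec, eventually_ge_atTop 1] with N hN hN1 x hx
    obtain ⟨hd1, hd2, hd3⟩ := hsep x hx
    have hs0 := hs N hN1
    set z := x - y
    set W : ℂ := s N * conj (ω : ℂ) / 2 * z
    have hWn : ‖W‖ = s N / 2 * ‖z‖ := norm_scale_mul hs0.le ω z
    have hWre : W.re ≤ c * ‖W‖ := by
      have : W = ((s N / 2 : ℝ) : ℂ) * (conj (ω : ℂ) * z) := by simp only [W]; push_cast; ring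
      rw [hWn, this, Complex.re_ofReal_mul, re_conj_mul]
      nlinarith
    set q : ℂ := ((k ^ 2 * ‖z‖ ^ 2 / 4 : ℝ) : ℂ)
    have hq : ‖q‖ ≤ Q := by
      rw [Complex.norm_real, Real.norm_of_nonneg (by positivity)]
      have h1 : ‖z‖ ^ 2 ≤ (2 * R) ^ 2 := by gcongr; linarith
      simp only [Q]
      nlinarith [sq_nonneg k]
    -- The angular condition is homogeneous, so the whole segment [0, W] lies in the decay region;
    -- ‖W‖ ≥ s(N)d/2 makes the bound uniform in x.
    have hray : ∀ t ∈ Set.Icc (0 : ℝ) 1,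
        ‖∑ m ∈ range (n * N + 1), mlCoeff n m * (t * W) ^ m‖ ≤
          K * (1 + t * (s N / 2 * d))⁻¹ + ε N ∧
        ‖∑ m ∈ range (n * N + 1), (m * mlCoeff n m) * (t * W) ^ m‖ ≤
          K * (1 + t * (s N / 2 * d))⁻¹ + ε N := fun t ht => by
      have ht0 := ht.1
      have h1 : ‖(t : ℂ) * W‖ = t * ‖W‖ := by
        rw [norm_mul, Complex.norm_real, Real.norm_of_nonneg ht.1]
      have h2 : (t * W).re ≤ c * ‖(t : ℂ) * W‖ := by
        rw [h1, Complex.re_ofReal_mul]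
        nlinarith
      have h3 : ‖(t : ℂ) * W‖ ≤ R₁ * s N := by
        rw [h1, hWn]
        calc t * (s N / 2 * ‖z‖) ≤ 1 * (s N / 2 * (2 * R₁)) := by gcongr; exact ht.2
          _ = _ := by ring
      have h4 : K * (1 + ‖(t : ℂ) * W‖)⁻¹ ≤ K * (1 + t * (s N / 2 * d))⁻¹ := by
        rw [h1, hWn]
        gcongr
      obtain ⟨h5, h6⟩ := hN _ h2 h3
      exact ⟨by linarith, by linarith⟩
    have ha : 0 < s N / 2 * d := by positivity
    obtain ⟨hb1, hb2⟩ := norm_sum_besselFactor_le_of_decay (range (n * N + 1)) (mlCoeff n)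
      (W := W) (q := q) ha hK hq fun t ht => (hray t ht).1
    obtain ⟨hb3, -⟩ := norm_sum_besselFactor_le_of_decay (range (n * N + 1))
      (fun m => m * mlCoeff n m) (W := W) (q := q) ha hK hq fun t ht => (hray t ht).2
    refine ⟨hb1, fun e he => ?_⟩
    have hz0 : z ≠ 0 := norm_pos_iff.mp (by linarith)
    have hη : 0 ≤ η₀ N := nonneg_of_mul_nonneg_right ((norm_nonneg _).trans hb1) (by positivity)
    have hf : fderiv ℝ (v N) x e =
        fderiv ℝ (besselSum (range (n * N + 1)) (mlCoeff n) (s N * conj (ω : ℂ) / 2) k) z e := by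
      simp only [v, z]
      rw [fderiv_comp_sub]
    rw [hf, fderiv_besselSum _ _ _ _ hz0]
    refine (norm_sub_le _ _).trans ?_
    rw [norm_mul, norm_mul, norm_div, he, Complex.norm_real, Real.norm_eq_abs, abs_mul]
    have hin : |inner ℝ z e| ≤ 2 * R := by
      have := abs_real_inner_le_norm z e
      rw [he, mul_one] at this
      linarith
    have hk2 : |k ^ 2 / 2| = k ^ 2 / 2 := abs_of_nonneg (by positivity)
    rw [hk2]
    calc _ ≤ 1 / d * (C₁ * η₀ N) + k ^ 2 / 2 * (2 * R) * (Real.exp Q * η₀ N) := by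
          gcongr
      _ = _ := by simp only [C₂]; ring
  refine tendsto_h1Norm_zero hDopen ?_ (fun N => ?_) (η := fun N => (C₁ + C₂) * η₀ N) ?_ ?_ ?_
  · exact ((Metric.isBounded_ball.subset (subset_closure.trans hDR)).measure_lt_top).ne
  · exact (contDiff_besselSum _ _ _ _).comp (contDiff_id.sub contDiff_const)
  · simpa using hη₀.const_mul (C₁ + C₂)
  · filter_upwards [key] with N hN x hx
    obtain ⟨h1, h2⟩ := hN x hx
    have h3 : 0 ≤ C₂ * η₀ N := (norm_nonneg _).trans (h2 1 (by simp))
    linarith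
  · filter_upwards [key] with N hN x hx e he
    obtain ⟨h1, h2⟩ := hN x hx
    have h3 : 0 ≤ C₁ * η₀ N := (norm_nonneg _).trans h1
    linarith [h2 e he]

/-! ### Boundary points in the cone and boundary length -/

lemma add_mul_mem_cone {y x : ℂ} {ω : Circle} {a : ℝ} (ha : 0 ≤ Real.cos a) (hx : x ∈ cone y ω a)
    {t : ℝ} (ht : 0 ≤ t) : x + t * (ω : ℂ) ∈ cone y ω a := by
  have hx' : ‖x - y‖ * Real.cos a < inner ℝ (x - y) (ω : ℂ) := hx
  have e : x + t * (ω : ℂ) - y = (x - y) + (t : ℝ) • (ω : ℂ) := by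
    rw [Complex.real_smul]; ring
  show ‖x + t * (ω : ℂ) - y‖ * Real.cos a < inner ℝ (x + t * (ω : ℂ) - y) (ω : ℂ)
  rw [e, inner_add_left, real_inner_smul_left, real_inner_self_eq_norm_sq, Circle.norm_coe]
  have h1 : ‖(x - y) + (t : ℝ) • (ω : ℂ)‖ ≤ ‖x - y‖ + t := by
    refine (norm_add_le _ _).trans ?_
    rw [norm_smul, Circle.norm_coe, Real.norm_of_nonneg ht, mul_one]
  have := Real.cos_le_one a
  nlinarith

lemma isOpen_cone (y : ℂ) (ω : Circle) (a : ℝ) : IsOpen (cone y ω a) :=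
  isOpen_lt (by fun_prop) (by fun_prop)

/-- A bounded open set meeting a cone has a boundary point in the cone. -/
lemma exists_mem_frontier_cone {D : Set ℂ} (hb : Bornology.IsBounded D) {y : ℂ} {ω : Circle} {a : ℝ}
    (ha : 0 ≤ Real.cos a) (hne : (cone y ω a ∩ D).Nonempty) : (cone y ω a ∩ frontier D).Nonempty := by
  obtain ⟨x, hxc, hxD⟩ := hne
  obtain ⟨r, hr⟩ := hb.subset_ball x
  -- The ray from x in direction ω stays in the cone but leaves the bounded set D; being connected,
  -- it meets the boundary.
  set S := (fun t : ℝ => x + t * (ω : ℂ)) '' Set.Ici 0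
  have hS : IsPreconnected S := isPreconnected_Ici.image _ (by fun_prop)
  have hSc : S ⊆ cone y ω a := by
    rintro _ ⟨t, ht, rfl⟩
    exact add_mul_mem_cone ha hxc ht
  have h1 : (S ∩ D).Nonempty := ⟨x, ⟨0, by simp, by simp⟩, hxD⟩
  have h2 : (S ∩ Dᶜ).Nonempty := by
    refine ⟨x + (|r| : ℝ) * (ω : ℂ), ⟨|r|, abs_nonneg r, rfl⟩, fun h => ?_⟩
    have := hr h
    rw [Metric.mem_ball, dist_eq_norm, add_sub_cancel_left, norm_mul, Circle.norm_coe, mul_one,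
      Complex.norm_real, Real.norm_eq_abs, abs_abs] at this
    exact absurd this (not_lt.mpr (le_abs_self r))
  by_contra hcon
  have hS2 : S ∩ frontier D = ∅ := by
    rw [Set.eq_empty_iff_forall_notMem]
    rintro z ⟨hz1, hz2⟩
    exact hcon ⟨z, hSc hz1, hz2⟩
  have hcover : S ⊆ interior D ∪ interior Dᶜ := fun z hz => by
    by_contra h
    rw [Set.mem_union, not_or, interior_compl, Set.notMem_compl_iff] at h
    have : z ∈ S ∩ frontier D := ⟨hz, h.2, h.1⟩
    rwa [hS2] at this
  have hdisj : S ∩ (interior D ∩ interior Dᶜ) = ∅ := by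
    rw [Set.eq_empty_iff_forall_notMem]
    rintro z ⟨-, h3, h4⟩
    exact interior_subset h4 (interior_subset h3)
  rcases isPreconnected_iff_subset_of_disjoint.mp hS _ _ isOpen_interior isOpen_interior hcover
    hdisj with h | h
  · obtain ⟨z, hz1, hz2⟩ := h2
    exact hz2 (interior_subset (h hz1))
  · obtain ⟨z, hz1, hz2⟩ := h1
    exact interior_subset (h hz1) hz2

lemma inner_mul_I_right (x : ℂ) (e : Circle) :
    x = (inner ℝ x (e : ℂ) : ℝ) * (e : ℂ) + (inner ℝ x (Complex.I * (e : ℂ)) : ℝ) * (Complex.I * e) := by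
  have h := Circle.normSq_coe e
  rw [Complex.normSq_apply] at h
  apply Complex.ext
  · simp [Complex.inner, Complex.mul_re]
    linear_combination (-x.re) * h
  · simp [Complex.inner, Complex.mul_re]
    linear_combination (-x.im) * h

lemma inner_frame (e : Circle) (a b : ℝ) :
    inner ℝ ((a : ℂ) * e + b * (Complex.I * e)) (e : ℂ) = a ∧
      inner ℝ ((a : ℂ) * e + b * (Complex.I * e)) (Complex.I * (e : ℂ)) = b := by
  have h := Circle.normSq_coe e
  rw [Complex.normSq_apply] at h
  constructor
  · simp [Complex.inner, Complex.mul_re]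
    linear_combination a * h
  · simp [Complex.inner, Complex.mul_re]
    linear_combination b * h

/-- Every boundary portion of a Lipschitz domain around a boundary point has positive length. -/
lemma hausdorffMeasure_frontier_inter_ball_pos {D : Set ℂ} (hDopen : IsOpen D)
    (hDlip : HasLipschitzBoundary D) {p : ℂ} (hp : p ∈ frontier D) {ρ : ℝ} (hρ : 0 < ρ) :
    MeasureTheory.Measure.hausdorffMeasure (1 : ℝ) (frontier D ∩ Metric.ball p ρ) ≠ 0 := by
  obtain ⟨r, e, K, f, hr, hf, hD⟩ := hDlip p hp
  have hfc := hf.continuous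
  have hc1 : Continuous fun x : ℂ => f (inner ℝ x (e : ℂ)) := by fun_prop
  have hc2 : Continuous fun x : ℂ => (inner ℝ x (Complex.I * (e : ℂ)) : ℝ) := by fun_prop
  have hpball : Metric.ball p r ∈ 𝓝 p := Metric.ball_mem_nhds p hr
  set Φ : ℝ → ℂ := fun t => (t : ℂ) * e + f t * (Complex.I * e)
  have hΦc : Continuous Φ := by fun_prop
  have hgraph : ∀ t, Φ t ∈ Metric.ball p r → Φ t ∈ frontier D := by
    intro t ht
    obtain ⟨h1, h2⟩ := inner_frame e t (f t)
    rw [hDopen.frontier_eq]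
    refine ⟨?_, fun h => ?_⟩
    · have hlim : Tendsto (fun u : ℝ => (t : ℂ) * e + ((f t + u : ℝ) : ℂ) * (Complex.I * e))
          (𝓝[>] 0) (𝓝 (Φ t)) := by
        have : Continuous fun u : ℝ => (t : ℂ) * e + ((f t + u : ℝ) : ℂ) * (Complex.I * e) := by
          fun_prop
        simpa [Φ] using (this.continuousWithinAt (s := Set.Ioi 0) (x := 0)).tendsto
      refine mem_closure_of_tendsto hlim ?_
      filter_upwards [self_mem_nhdsWithin, hlim.eventually (Metric.isOpen_ball.mem_nhds ht)]
        with u hu hub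
      obtain ⟨h3, h4⟩ := inner_frame e t (f t + u)
      rw [hD _ hub, h3, h4]
      have : 0 < u := hu
      linarith
    · rw [hD _ ht, h1, h2] at h
      exact lt_irrefl _ h
  have hpeq : f (inner ℝ p (e : ℂ)) = inner ℝ p (Complex.I * (e : ℂ)) := by
    rw [hDopen.frontier_eq] at hp
    refine le_antisymm ?_ ?_
    · by_contra! hlt
      have hev : ∀ᶠ x in 𝓝 p, x ∉ D := by
        filter_upwards [hpball, hc2.continuousAt.eventually_lt hc1.continuousAt hlt] with x hx1 hx2
        rw [hD x hx1]
        exact not_lt.mpr hx2.le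
      exact (mem_closure_iff_frequently.mp hp.1) hev
    · by_contra! hlt
      exact hp.2 ((hD p (Metric.mem_ball_self hr)).mpr hlt)
  set t₀ := inner ℝ p (e : ℂ)
  have hΦp : Φ t₀ = p := by
    simp only [Φ]
    rw [hpeq]
    exact (inner_mul_I_right p e).symm
  have hnear : ∀ᶠ t in 𝓝 t₀, Φ t ∈ Metric.ball p (min r ρ) := by
    refine hΦc.continuousAt.eventually (Metric.isOpen_ball.mem_nhds ?_)
    rw [hΦp]
    exact Metric.mem_ball_self (lt_min hr hρ)
  obtain ⟨δ, hδ, hball⟩ := Metric.eventually_nhds_iff_ball.mp hnear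
  -- Projection onto the e-axis is 1-Lipschitz and maps this piece of boundary onto a set containing
  -- an interval, so the piece cannot have zero length.
  have hsub : Metric.ball t₀ δ ⊆
      (fun x : ℂ => (inner ℝ x (e : ℂ) : ℝ)) '' (frontier D ∩ Metric.ball p ρ) := by
    intro t ht
    have h1 := hball t ht
    exact ⟨Φ t, ⟨hgraph t (Metric.ball_subset_ball (min_le_left _ _) h1),
      Metric.ball_subset_ball (min_le_right _ _) h1⟩, (inner_frame e t (f t)).1⟩
  have hlip : LipschitzWith 1 fun x : ℂ => (inner ℝ x (e : ℂ) : ℝ) := by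
    refine LipschitzWith.of_dist_le_mul fun x x' => ?_
    rw [dist_eq_norm, dist_eq_norm, ← inner_sub_left, NNReal.coe_one, one_mul]
    refine (norm_inner_le_norm _ _).trans ?_
    rw [Circle.norm_coe, mul_one]
  intro hzero
  have h1 := hlip.hausdorffMeasure_image_le (d := 1) zero_le_one (frontier D ∩ Metric.ball p ρ)
  rw [hzero, mul_zero, MeasureTheory.hausdorffMeasure_real] at h1
  have h2 := (MeasureTheory.measure_mono hsub).trans h1
  rw [Real.volume_ball] at h2
  simp only [nonpos_iff_eq_zero, ENNReal.ofReal_eq_zero] at h2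
  linarith

lemma tendsto_l2BoundaryNorm_top {D T : Set ℂ} (hT : MeasurableSet T) (hTD : T ⊆ frontier D)
    (hpos : MeasureTheory.Measure.hausdorffMeasure (1 : ℝ) T ≠ 0) {v : ℕ → ℂ → ℂ} {M : ℕ → ℝ}
    (hM : Tendsto M atTop atTop) (hv : ∀ᶠ N in atTop, ∀ x ∈ T, M N ≤ ‖v N x‖) :
    Tendsto (fun N => l2BoundaryNorm D (v N)) atTop (𝓝 ⊤) := by
  set μ : MeasureTheory.Measure ℂ := MeasureTheory.Measure.hausdorffMeasure (1 : ℝ)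
  have hc : μ T ^ (2 : ℝ)⁻¹ ≠ 0 := by
    rw [Ne, ENNReal.rpow_eq_zero_iff_of_pos (by norm_num)]
    exact hpos
  have hlim : Tendsto (fun N => ENNReal.ofReal (M N) * μ T ^ (2 : ℝ)⁻¹) atTop (𝓝 ⊤) := by
    have := ENNReal.Tendsto.mul_const (ENNReal.tendsto_ofReal_atTop.comp hM)
      (b := μ T ^ (2 : ℝ)⁻¹) (Or.inl ENNReal.top_ne_zero)
    rwa [ENNReal.top_mul hc] at this
  refine tendsto_of_tendsto_of_tendsto_of_le_of_le' hlim tendsto_const_nhds ?_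
    (Eventually.of_forall fun _ => le_top)
  filter_upwards [hv, hM.eventually_ge_atTop 0] with N hN hN0
  have h1 : MeasureTheory.eLpNorm (fun _ : ℂ => M N) 2 (μ.restrict T) ≤
      MeasureTheory.eLpNorm (v N) 2 (μ.restrict T) := by
    refine MeasureTheory.eLpNorm_mono_ae ?_
    refine (MeasureTheory.ae_restrict_iff' hT).mpr (Eventually.of_forall fun x hx => ?_)
    rw [Real.norm_of_nonneg hN0]
    exact hN x hx
  have h2 : MeasureTheory.eLpNorm (v N) 2 (μ.restrict T) ≤
      MeasureTheory.eLpNorm (v N) 2 (μ.restrict (frontier D)) :=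
    MeasureTheory.eLpNorm_mono_measure _ (MeasureTheory.Measure.restrict_mono hTD le_rfl)
  refine le_trans ?_ (h1.trans h2)
  rw [MeasureTheory.eLpNorm_const' _ (by norm_num) (by norm_num)]
  simp [Real.enorm_of_nonneg hN0]

/-! ### Blow-up inside the cone -/

lemma integral_exp_mul_le {X : ℝ} (hX : 0 < X) :
    ∫ t in (0 : ℝ)..1, Real.exp (t * X) ≤ Real.exp X / X := by
  have hd : ∀ t ∈ Set.uIcc (0 : ℝ) 1,
      HasDerivAt (fun t => Real.exp (t * X) / X) (Real.exp (t * X)) t := fun t _ => by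
    have := (((hasDerivAt_id t).mul_const X).exp).div_const X
    refine this.congr_deriv ?_
    simp only [id]
    field_simp
  rw [intervalIntegral.integral_eq_sub_of_hasDerivAt hd
    (Continuous.intervalIntegrable (by fun_prop) _ _)]
  have : 0 ≤ Real.exp (0 * X) / X := by positivity
  rw [one_mul]
  linarith

set_option maxHeartbeats 1000000 in
/-- The Herglotz functions blow up on boundaries of Lipschitz domains meeting the open cone. -/
theorem tendsto_l2BoundaryNorm_herglotz
    {k R γ₀ γ : ℝ} (hk : 0 < k) {D : Set ℂ} (hDopen : IsOpen D) (hDlip : HasLipschitzBoundary D)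
    (hDR : closure D ⊆ Metric.ball 0 R)
    (hγ₀eq : Real.log γ₀ + γ₀ / Real.exp 1 = 0) (hγ : 0 < γ) (hγγ₀ : γ < γ₀)
    {n : ℕ} (hn : 1 ≤ n) {s : ℕ → ℝ} (hs : ∀ N, 1 ≤ N → 0 < s N)
    (hsN : (fun N : ℕ => (R * s N) ^ n - γ / Real.exp 1 * N) =O[atTop] (fun _ : ℕ => (1 : ℝ)))
    {y : ℂ} (hy : y ∈ Metric.ball (0 : ℂ) R) (ω : Circle)
    (hne : (cone y ω (π / (2 * n)) ∩ D).Nonempty) :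
    Tendsto (fun N : ℕ => l2BoundaryNorm D (herglotz k (density n N y ω (s N) k)))
      atTop (𝓝 ⊤) := by
  have hpi := Real.pi_pos
  have hn1 : (1 : ℝ) ≤ n := by exact_mod_cast hn
  have hy' : ‖y‖ < R := by simpa using hy
  have hR0 : 0 < R := (norm_nonneg y).trans_lt hy'
  set a := π / (2 * n)
  have ha0 : 0 < a := by positivity
  have ha1 : a ≤ π / 2 := by simp only [a]; gcongr; linarith
  have hcosa : 0 ≤ Real.cos a := Real.cos_nonneg_of_mem_Icc ⟨by linarith, ha1⟩
  obtain ⟨p, hpc, hpf⟩ := exists_mem_frontier_cone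
    (Metric.isBounded_ball.subset (subset_closure.trans hDR)) hcosa hne
  obtain ⟨ρ, hρ, hρc⟩ := Metric.nhds_basis_closedBall.mem_iff.mp ((isOpen_cone y ω a).mem_nhds hpc)
  have hcomp : IsCompact (Metric.closedBall p ρ) := isCompact_closedBall p ρ
  have hnonempty : (Metric.closedBall p ρ).Nonempty := ⟨p, Metric.mem_closedBall_self hρ.le⟩
  have hzpos : ∀ x ∈ Metric.closedBall p ρ, 0 < ‖x - y‖ := fun x hx => by
    refine norm_pos_iff.mpr fun h => ?_
    have h1 : ‖x - y‖ * Real.cos a < inner ℝ (x - y) (ω : ℂ) := hρc hx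
    rw [h] at h1
    simp at h1
  -- Compactness of a closed ball inside the open cone gives a uniform angle θ₁ < π/2n and a uniform
  -- distance d from the vertex.
  obtain ⟨x₁, hx₁, hmin₁⟩ := hcomp.exists_isMinOn hnonempty
    (f := fun x => inner ℝ (x - y) (ω : ℂ) / ‖x - y‖)
    (ContinuousOn.div (by fun_prop) (by fun_prop) fun x hx => (hzpos x hx).ne')
  obtain ⟨x₂, hx₂, hmin₂⟩ := hcomp.exists_isMinOn hnonempty (f := fun x => ‖x - y‖) (by fun_prop)
  set c := inner ℝ (x₁ - y) (ω : ℂ) / ‖x₁ - y‖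
  set d := ‖x₂ - y‖
  have hd : 0 < d := hzpos x₂ hx₂
  have hc : Real.cos a < c := by
    rw [lt_div_iff₀ (hzpos _ hx₁), mul_comm]
    exact hρc hx₁
  have hc1 : c ≤ 1 := by
    rw [div_le_one (hzpos _ hx₁)]
    have := real_inner_le_norm (x₁ - y) (ω : ℂ)
    rwa [Circle.norm_coe, mul_one] at this
  set θ₁ := Real.arccos c
  have hθ₁ : n * θ₁ < π / 2 := by
    have h1 : θ₁ < a := by
      rw [← Real.arccos_cos ha0.le (by linarith : a ≤ π)]
      exact Real.arccos_lt_arccos (by linarith) hc hc1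
    calc n * θ₁ < n * a := by gcongr
      _ = π / 2 := by simp only [a]; field_simp
  have hθ₁0 : 0 ≤ θ₁ := Real.arccos_nonneg c
  set κ := Real.cos (n * θ₁)
  have hκ : 0 < κ := Real.cos_pos_of_mem_Ioo
    ⟨by have : 0 ≤ n * θ₁ := by positivity
        linarith, hθ₁⟩
  obtain ⟨r₀, hr₀⟩ := exists_lower_bound_sector hn hθ₁
  obtain ⟨K, hK0, hK⟩ := exists_bound_growth_sector hn hκ
  obtain ⟨ε, hε, hε0, hε'⟩ := exists_truncation_error hn hγ₀eq hγ hγγ₀ hsN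
  have hscale := tendsto_scale_atTop hR0 hγ hsN hs
  set Q := k ^ 2 * R ^ 2
  have hQ : 0 ≤ Q := by positivity
  set C := Q * Real.exp Q
  have hC : 0 ≤ C := by positivity
  -- A lower bound for Re W^n, uniform over the ball.
  set X₀ : ℕ → ℝ := fun N => (s N / 2 * d) ^ n * κ
  have hsd : Tendsto (fun N => s N / 2 * d) atTop atTop :=
    (hscale.atTop_div_const two_pos).atTop_mul_const hd
  have hX₀ : Tendsto X₀ atTop atTop :=
    ((tendsto_pow_atTop (by omega : n ≠ 0)).comp hsd).atTop_mul_const hκ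
  -- Of the main term e^X/4 with X = Re W^n, the Bessel correction consumes at most e^X/8, and e^X ≥
  -- X₀. Truncation errors enter once from the sum and C times from the integral.
  refine tendsto_l2BoundaryNorm_top (T := frontier D ∩ Metric.ball p ρ)
    (M := fun N => X₀ N / 8 - (1 + C) * ε N)
    (isClosed_frontier.measurableSet.inter measurableSet_ball) Set.inter_subset_left
    (hausdorffMeasure_frontier_inter_ball_pos hDopen hDlip hpf hρ) ?_ ?_
  · have h1 : Tendsto (fun N => -((1 + C) * ε N)) atTop (𝓝 (-((1 + C) * 0))) :=
      (hε.const_mul (1 + C)).neg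
    simpa [sub_eq_add_neg] using (hX₀.atTop_div_const (by norm_num : (0 : ℝ) < 8)).atTop_add h1
  filter_upwards [hε', eventually_ge_atTop 1, hsd.eventually_ge_atTop r₀,
    hX₀.eventually_ge_atTop (8 * (C * K)), hX₀.eventually_gt_atTop 0] with N hN hN1 hNr hNX hNX0
  rintro x ⟨hxf, hxb⟩
  have hs0 := hs N hN1
  have hxcl := Metric.ball_subset_closedBall hxb
  set z := x - y
  have hz := hzpos x hxcl
  have hzd : d ≤ ‖z‖ := hmin₂ hxcl
  have hzc : c ≤ inner ℝ z (ω : ℂ) / ‖z‖ := hmin₁ hxcl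
  have hzR : ‖z‖ ≤ 2 * R := by
    have h1 : ‖x‖ < R := by simpa using hDR (frontier_subset_closure hxf)
    have := norm_sub_le x y
    linarith
  set W : ℂ := s N * conj (ω : ℂ) / 2 * z
  set u : ℂ := conj (ω : ℂ) * z
  have hun : ‖u‖ = ‖z‖ := by
    rw [norm_mul, RCLike.norm_conj, Circle.norm_coe, one_mul]
  have hu0 : u ≠ 0 := norm_pos_iff.mp (by rw [hun]; exact hz)
  set θ := Complex.arg u
  set r := s N / 2 * ‖z‖
  have hr : 0 < r := by positivity
  have hrd : s N / 2 * d ≤ r := by simp only [r]; gcongr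
  have hW : W = (r : ℂ) * Complex.exp (θ * Complex.I) := by
    have h1 := Complex.norm_mul_exp_arg_mul_I u
    rw [hun] at h1
    have h2 : W = ((s N / 2 : ℝ) : ℂ) * u := by simp only [W, u]; push_cast; ring
    rw [h2, ← h1]
    simp only [r]
    push_cast
    ring
  have hθ : |θ| ≤ θ₁ := by
    rw [← Real.arccos_cos (abs_nonneg θ) (Complex.abs_arg_le_pi u), Real.cos_abs,
      Complex.cos_arg hu0, hun, re_conj_mul]
    exact Real.arccos_le_arccos hzc
  have hln : κ ≤ (Complex.exp (θ * Complex.I) ^ n).re := by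
    rw [exp_mul_I_pow_re, ← Real.cos_abs (n * θ)]
    refine Real.cos_le_cos_of_nonneg_of_le_pi (abs_nonneg _) (by linarith) ?_
    rw [abs_mul, Nat.abs_cast]
    gcongr
  set X := (W ^ n).re
  have hXeq : ∀ t : ℝ, (((t * r : ℝ) : ℂ) * Complex.exp (θ * Complex.I)) = t * W := fun t => by
    rw [hW]; push_cast; ring
  have hXt : ∀ t : ℝ, ((t * W) ^ n).re = t ^ n * X := fun t => by
    rw [mul_pow, ← Complex.ofReal_pow, Complex.re_ofReal_mul]
  have hX : X₀ N ≤ X := by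
    have h1 : X = (Complex.exp (θ * Complex.I) ^ n).re * r ^ n := by
      simp only [X]
      rw [hW, re_ray_pow]
    rw [h1, mul_comm]
    simp only [X₀]
    gcongr
  have hXpos : 0 < X := hNX0.trans_le hX
  have hWn : ‖W‖ = r := norm_scale_mul hs0.le ω z
  have hWR : ∀ t ∈ Set.Icc (0 : ℝ) 1, ‖(t : ℂ) * W‖ ^ n ≤ (R * s N) ^ n := fun t ht => by
    rw [norm_mul, hWn, Complex.norm_real, Real.norm_of_nonneg ht.1]
    refine pow_le_pow_left₀ (mul_nonneg ht.1 hr.le) ?_ n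
    · calc t * r ≤ 1 * (s N / 2 * (2 * R)) := by
            simp only [r]; gcongr; exact ht.2
        _ = _ := by ring
  have hlow : Real.exp X / 4 - ε N ≤
      ‖∑ m ∈ range (n * N + 1), mlCoeff n m * W ^ m‖ := by
    have h1 := hr₀ r θ (hNr.trans hrd) hθ
    rw [← hW] at h1
    have h2 := hN W (by simpa using hWR 1 ⟨zero_le_one, le_rfl⟩)
    have h3 := norm_sub_norm_le (mittagLeffler n W) (truncated n N W)
    rw [norm_sub_rev] at h3
    change Real.exp X / 4 - ε N ≤ ‖truncated n N W‖
    linarith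
  have hup : ∀ t ∈ Set.Icc (0 : ℝ) 1,
      ‖∑ m ∈ range (n * N + 1), mlCoeff n m * (t * W) ^ m‖ ≤
        K * Real.exp (t * X) + ε N := fun t ht => by
    have h1 := hK (Complex.exp (θ * Complex.I)) (t * r) (Complex.norm_exp_ofReal_mul_I θ)
      (mul_nonneg ht.1 hr.le) hln
    rw [hXeq, hXt] at h1
    have h2 := hN (t * W) (hWR t ht)
    have h3 := norm_sub_norm_le (truncated n N (t * W)) (mittagLeffler n (t * W))
    -- t^n ≤ t on [0, 1] replaces the integrand by e^{tX}, whose integral gains the factor 1/X.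
    have h4 : K * Real.exp (t ^ n * X) ≤ K * Real.exp (t * X) := by
      gcongr
      exact pow_le_of_le_one ht.1 ht.2 (by omega)
    change ‖truncated n N (t * W)‖ ≤ _
    linarith
  have hint : ∫ t in (0 : ℝ)..1, ‖∑ m ∈ range (n * N + 1), mlCoeff n m * (t * W) ^ m‖ ≤
      K * (Real.exp X / X) + ε N := by
    have h1 := intervalIntegral.integral_mono_on (μ := MeasureTheory.volume) zero_le_one
      (Continuous.intervalIntegrable (by fun_prop) 0 1)
      (Continuous.intervalIntegrable (u := fun t : ℝ => K * Real.exp (t * X) + ε N)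
        (by fun_prop) 0 1) hup
    refine h1.trans ?_
    rw [intervalIntegral.integral_add (Continuous.intervalIntegrable (by fun_prop) _ _)
      intervalIntegrable_const, intervalIntegral.integral_const_mul]
    have h2 := integral_exp_mul_le hXpos
    simp only [intervalIntegral.integral_const, sub_zero, one_smul]
    gcongr
  set q : ℂ := ((k ^ 2 * ‖z‖ ^ 2 / 4 : ℝ) : ℂ)
  have hq : ‖q‖ ≤ Q := by
    rw [Complex.norm_real, Real.norm_of_nonneg (by positivity)]
    have h1 : ‖z‖ ^ 2 ≤ (2 * R) ^ 2 := by gcongr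
    simp only [Q]
    nlinarith [sq_nonneg k]
  have hdiff := norm_sum_besselFactor_sub_le (range (n * N + 1)) (mlCoeff n) W q
  have hI : 0 ≤ ∫ t in (0 : ℝ)..1, ‖∑ m ∈ range (n * N + 1), mlCoeff n m * (t * W) ^ m‖ :=
    intervalIntegral.integral_nonneg zero_le_one fun _ _ => norm_nonneg _
  have hdiff' : ‖q‖ * Real.exp ‖q‖ *
      ∫ t in (0 : ℝ)..1, ‖∑ m ∈ range (n * N + 1), mlCoeff n m * (t * W) ^ m‖ ≤
      C * (K * (Real.exp X / X) + ε N) := by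
    simp only [C]
    gcongr
  rw [herglotz_density hk]
  have h1 := norm_sub_norm_le (∑ m ∈ range (n * N + 1), mlCoeff n m * W ^ m)
    (∑ m ∈ range (n * N + 1), mlCoeff n m * W ^ m * besselFactor m q)
  rw [norm_sub_rev] at h1
  have h2 : C * (K * (Real.exp X / X)) ≤ Real.exp X / 8 := by
    have h3 : 8 * (C * K) ≤ X := hNX.trans hX
    have h4 : C * (K * (Real.exp X / X)) = C * K / X * Real.exp X := by ring
    have h5 : C * K / X ≤ 1 / 8 := by rw [div_le_div_iff₀ hXpos (by norm_num)]; linarith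
    rw [h4]
    calc _ ≤ 1 / 8 * Real.exp X := by gcongr
      _ = _ := by ring
  have h6 : X₀ N ≤ Real.exp X := hX.trans (by linarith [Real.add_one_le_exp X])
  change X₀ N / 8 - (1 + C) * ε N ≤
    ‖∑ m ∈ range (n * N + 1), mlCoeff n m * W ^ m * besselFactor m q‖
  linarith

end HerglotzCone

end

theorem lemma1p2
    (k R γ₀ γ : ℝ) (hk : 0 < k)
    (D : Set ℂ) (hDopen : IsOpen D) (hDlip : HerglotzCone.HasLipschitzBoundary D)
    (hDR : closure D ⊆ Metric.ball 0 R)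
    (hγ₀ : 0 < γ₀) (hγ₀eq : Real.log γ₀ + γ₀ / Real.exp 1 = 0)
    (hγ : 0 < γ) (hγγ₀ : γ < γ₀)
    (n : ℕ) (hn : 1 ≤ n)
    (s : ℕ → ℝ) (hs : ∀ N, 1 ≤ N → 0 < s N)
    (hsN : (fun N : ℕ => (R * s N) ^ n - γ / Real.exp 1 * N) =O[Filter.atTop]
      (fun _ : ℕ => (1 : ℝ)))
    (y : ℂ) (hy : y ∈ Metric.ball (0 : ℂ) R) (ω : Circle) :
    (closure (HerglotzCone.cone y ω (π / (2 * n))) ∩ closure D = ∅ →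
      Filter.Tendsto
        (fun N : ℕ => HerglotzCone.h1Norm D
          (HerglotzCone.herglotz k (HerglotzCone.density n N y ω (s N) k)))
        Filter.atTop (𝓝 0)) ∧
    ((HerglotzCone.cone y ω (π / (2 * n)) ∩ D).Nonempty →
      Filter.Tendsto
        (fun N : ℕ => HerglotzCone.l2BoundaryNorm D
          (HerglotzCone.herglotz k (HerglotzCone.density n N y ω (s N) k)))
        Filter.atTop (𝓝 ⊤)) :=
  ⟨HerglotzCone.tendsto_h1Norm_herglotz hk hDopen hDR hγ₀eq hγ hγγ₀ hn hs hsN hy ω,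
    HerglotzCone.tendsto_l2BoundaryNorm_herglotz hk hDopen hDlip hDR hγ₀eq hγ hγγ₀ hn hs hsN hy ω⟩
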